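/- Let $\mathscr{C}$ be either the category of Banach Abelian groups (Abelian groups with a complete norm) and bounded homomorphisms, or its full subcategory of non-Archimedean (ultrametric) ones. Let $R$ be a commutative unital Banach ring in $\mathscr{C}$, i.e. a commutative ring with a complete norm (ultrametric in the second case) such that $\|ab\| \le C\|a\|\,\|b\|$ for some constant $C$. Let $\mathrm{Mod}_{\mathscr{C}}(R)$ be the category of Banach $R$-modules in $\mathscr{C}$ and bounded $R$-linear maps, $\mathrm{Alg}_{\mathscr{C}}(R)$ the category of commutative Banach $R$-algebras in $\mathscr{C}$ and bounded $R$-algebra homomorphisms, $\widehat\otimes_R$ the completed tensor product and $\widehat\otimes_R^{\mathbb L}$ its left derived functor, computed by projective resolutions (projective means: lifting along strict epimorphisms). A morphism is strict if its coimage maps isomorphically to its image; a sequence $X \xrightarrow{f} Y \xrightarrow{g} Z$ is strictly exact at $Y$ if $\mathrm{im} f = \ker g$ and $f$ is strict. A morphism $R \to B$ of Banach rings is a homotopy epimorphism if the multiplication $B \widehat\otimes_R^{\mathbb L} B \to B$ is an isomorphism in the bounded above derived category of $\mathrm{Mod}_{\mathscr{C}}(R)$, i.e. is represented by a quasi-isomorphism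 (a chain map with strictly exact mapping cone). A set $S$ of objects of $\mathrm{Alg}_{\mathscr{C}}(R)$ is a derived (resp. non-derived) cover of $R$ if $R \to B$ is a homotopy epimorphism (resp. an epimorphism in $\mathrm{Alg}_{\mathscr{C}}(R)$) for every $B \in S$, and there are finitely many distinct $B_1, \dots, B_m \in S$ such that the total complex of the derived Tate–Čech complex $$0 \to R \to \prod_{i} B_i \to \prod_{i<j} B_i \widehat\otimes_R^{\mathbb L} B_j \to \prod_{i<j<k} B_i \widehat\otimes_R^{\mathbb L} B_j \widehat\otimes_R^{\mathbb L} B_k \to \cdots$$ (resp. the complex with the same shape with $\widehat\otimes_R$ in place of $\widehat\otimes_R^{\mathbb L}$) is strictly exact. 1. For every idempotent $e \in R$, the ideal $eR$ is closed, $R/eR$ (with the quotient norm) is a projective object of $\mathrm{Mod}_{\mathscr{C}}(R)$, and the quotient map $R \to R/eR$ is a homotopy epimorphism. 2. Let $E \subset R$ be a finite set of pairwise orthogonal idempotents with $\sum_{e \in E} e = 1$. If $E \ne \{1\}$ or $R = 0$, then $\{R/eR \mid e \in E\}$ is both a derived and a non-derived cover of $R$. Moreover, without any restriction on $E$, the set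 $\{R/(1-e)R \mid e \in E\}$, which corresponds to the disjoint clopen cover given by $E$, is both a derived and a non-derived cover of $R$. -/

import Mathlib

open scoped TensorProduct

universe u

/-- The two ambient categories: `arch` is the category of all Banach Abelian groups, `nonarch` the
full subcategory of the non-Archimedean (ultrametric) ones; morphisms are the bounded
homomorphisms. -/
inductive BanachKind where
  | arch
  | nonarch

/-- A commutative Banach ring: a commutative unital ring with a complete norm whose multiplication
is bounded. Neither submultiplicativity nor `‖1‖ = 1` is assumed. -/
class BanachRing (R : Type u) extends CommRing R, Norm R, MetricSpace R where
  dist_eq_norm_sub : ∀ x y : R, dist x y = ‖x - y‖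
  complete : CompleteSpace R
  exists_mul_bound : ∃ C : ℝ, ∀ a b : R, ‖a * b‖ ≤ C * ‖a‖ * ‖b‖

instance BanachRing.toNormedAddCommGroup (R : Type u) [h : BanachRing R] :
    NormedAddCommGroup R where
  __ := h
  dist_eq x y := by rw [dist_comm, BanachRing.dist_eq_norm_sub, sub_eq_neg_add]

instance BanachRing.instCompleteSpace (R : Type u) [BanachRing R] : CompleteSpace R :=
  BanachRing.complete

/-- `M` is an object of the ambient category `𝒞`. -/
class IsOfKind (𝒞 : BanachKind) (M : Type u) [NormedAddCommGroup M] : Prop where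
  ultra : 𝒞 = BanachKind.nonarch → IsUltrametricDist M

/-- Objects of `Mod_𝒞(A)`: Banach `A`-modules (ultrametric ones if `𝒞 = nonarch`). -/
structure BanMod (𝒞 : BanachKind) (A : Type u) [BanachRing A] where
  carrier : Type u
  [normed : NormedAddCommGroup carrier]
  [module : Module A carrier]
  [complete : CompleteSpace carrier]
  [kind : IsOfKind 𝒞 carrier]
  exists_smul_bound : ∃ C : ℝ, ∀ (a : A) (m : carrier), ‖a • m‖ ≤ C * ‖a‖ * ‖m‖

namespace BanMod

variable {𝒞 : BanachKind} {A : Type u} [BanachRing A]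

instance : CoeSort (BanMod 𝒞 A) (Type u) := ⟨BanMod.carrier⟩

attribute [instance] BanMod.normed BanMod.module BanMod.complete BanMod.kind

end BanMod

/-- Morphisms of `Mod_𝒞(A)`: bounded `A`-linear maps. -/
structure BanHom {𝒞 : BanachKind} {A : Type u} [BanachRing A] (M N : BanMod 𝒞 A)
    extends M →ₗ[A] N where
  exists_bound : ∃ C : ℝ, ∀ x, ‖toFun x‖ ≤ C * ‖x‖

namespace BanHom

variable {𝒞 : BanachKind} {A : Type u} [BanachRing A] {M N T : BanMod 𝒞 A}

instance : FunLike (BanHom M N) M N where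
  coe f := f.toFun
  coe_injective f g h := by
    cases f; cases g; congr; exact DFunLike.coe_injective h

instance : LinearMapClass (BanHom M N) A M N where
  map_add f := f.map_add
  map_smulₛₗ f := f.map_smul

theorem bound (f : BanHom M N) : ∃ C : ℝ, 0 ≤ C ∧ ∀ x, ‖f x‖ ≤ C * ‖x‖ := by
  obtain ⟨C, hC⟩ := f.exists_bound
  exact ⟨max C 0, le_max_right _ _, fun x => (hC x).trans (by gcongr; exact le_max_left _ _)⟩

/-- The identity morphism. -/
def id (M : BanMod 𝒞 A) : BanHom M M where
  toLinearMap := LinearMap.id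
  exists_bound := ⟨1, fun x => by simp⟩

/-- Composition of morphisms. -/
def comp (g : BanHom N T) (f : BanHom M N) : BanHom M T where
  toLinearMap := g.toLinearMap ∘ₗ f.toLinearMap
  exists_bound := by
    obtain ⟨C, hC, hf⟩ := f.bound
    obtain ⟨D, hD, hg⟩ := g.bound
    refine ⟨D * C, fun x => (hg _).trans ?_⟩
    rw [mul_assoc]
    exact mul_le_mul_of_nonneg_left (hf x) hD

/-- The sum of two morphisms. -/
instance : Add (BanHom M N) where
  add f g :=
    { toLinearMap := f.toLinearMap + g.toLinearMap
      exists_bound := by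
        obtain ⟨C, hC, hf⟩ := f.bound
        obtain ⟨D, hD, hg⟩ := g.bound
        refine ⟨C + D, fun x => (norm_add_le _ _).trans ?_⟩
        rw [add_mul]
        exact add_le_add (hf x) (hg x) }

/-- The zero morphism. -/
instance : Zero (BanHom M N) where
  zero :=
    { toLinearMap := 0
      exists_bound := ⟨0, fun x => by simp⟩ }

/-- The opposite of a morphism. -/
instance : Neg (BanHom M N) where
  neg f :=
    { toLinearMap := -f.toLinearMap
      exists_bound := by
        obtain ⟨C, hC⟩ := f.exists_bound
        exact ⟨C, fun x => (norm_neg _).trans_le (hC x)⟩ }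

theorem add_apply (f g : BanHom M N) (x : M) : (f + g) x = f x + g x := rfl

theorem zero_apply (x : M) : (0 : BanHom M N) x = 0 := rfl

theorem neg_apply (f : BanHom M N) (x : M) : (-f) x = -f x := rfl

instance : AddCommGroup (BanHom M N) where
  add_assoc f g h := DFunLike.ext _ _ fun x => add_assoc (f x) (g x) (h x)
  zero_add f := DFunLike.ext _ _ fun x => zero_add (f x)
  add_zero f := DFunLike.ext _ _ fun x => add_zero (f x)
  nsmul := nsmulRec
  zsmul := zsmulRec
  neg_add_cancel f := DFunLike.ext _ _ fun x => neg_add_cancel (f x)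
  add_comm f g := DFunLike.ext _ _ fun x => add_comm (f x) (g x)

theorem zsmul_apply (k : ℤ) (f : BanHom M N) (x : M) : (k • f) x = k • f x :=
  map_zsmul (⟨⟨fun f : BanHom M N => f x, rfl⟩, fun _ _ => rfl⟩ : BanHom M N →+ N) k f

theorem sum_apply {ι : Type*} (s : Finset ι) (f : ι → BanHom M N) (x : M) :
    (∑ i ∈ s, f i) x = ∑ i ∈ s, f i x :=
  map_sum (⟨⟨fun f : BanHom M N => f x, rfl⟩, fun _ _ => rfl⟩ : BanHom M N →+ N) f s

theorem comp_apply (g : BanHom N T) (f : BanHom M N) (x : M) : (g.comp f) x = g (f x) := rfl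

theorem id_apply (x : M) : (BanHom.id M) x = x := rfl

theorem comp_assoc {U : BanMod 𝒞 A} (h : BanHom T U) (g : BanHom N T) (f : BanHom M N) :
    (h.comp g).comp f = h.comp (g.comp f) := rfl

theorem id_comp (f : BanHom M N) : (BanHom.id N).comp f = f := rfl

theorem comp_id (f : BanHom M N) : f.comp (BanHom.id M) = f := rfl

theorem zero_comp (f : BanHom M N) : (0 : BanHom N T).comp f = 0 := rfl

theorem comp_add (g : BanHom N T) (f f' : BanHom M N) :
    g.comp (f + f') = g.comp f + g.comp f' :=
  DFunLike.ext _ _ fun x => map_add g (f x) (f' x)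

theorem comp_zsmul (g : BanHom N T) (k : ℤ) (f : BanHom M N) :
    g.comp (k • f) = k • g.comp f :=
  DFunLike.ext _ _ fun x => by
    rw [comp_apply, zsmul_apply, zsmul_apply, map_zsmul, comp_apply]

theorem add_comp (g g' : BanHom N T) (f : BanHom M N) :
    (g + g').comp f = g.comp f + g'.comp f := rfl

theorem zsmul_comp (k : ℤ) (g : BanHom N T) (f : BanHom M N) :
    (k • g).comp f = k • g.comp f :=
  DFunLike.ext _ _ fun x => by
    rw [comp_apply, zsmul_apply, zsmul_apply, comp_apply]

/-- `f` is strict, i.e. the canonical map from the coimage `M / ker f` to the image (the closure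
of the range) is an isomorphism: it is onto, and its inverse is bounded. -/
def IsStrict (f : BanHom M N) : Prop :=
  IsClosed (Set.range f) ∧ ∃ C : ℝ, ∀ x : M, ∃ x' : M, f x' = f x ∧ ‖x'‖ ≤ C * ‖f x‖

end BanHom

/-- The sequence `f`, `g` is strictly exact at the middle term: the image of `f` (the closure of its
range) is the kernel of `g`, and `f` is strict. -/
def StrictExactAt {𝒞 : BanachKind} {A : Type u} [BanachRing A] {M N T : BanMod 𝒞 A}
    (f : BanHom M N) (g : BanHom N T) : Prop :=
  closure (Set.range f) = {y | g y = 0} ∧ f.IsStrict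

namespace BanMod

variable {𝒞 : BanachKind} {A : Type u} [BanachRing A]

/-- The regular module. -/
def regular (𝒞 : BanachKind) (A : Type u) [BanachRing A] [IsOfKind 𝒞 A] : BanMod 𝒞 A where
  carrier := A
  exists_smul_bound := BanachRing.exists_mul_bound

/-- The zero module. -/
def zero (𝒞 : BanachKind) (A : Type u) [BanachRing A] : BanMod 𝒞 A where
  carrier := PUnit
  kind := ⟨fun _ => ⟨fun x y z => by simp⟩⟩
  exists_smul_bound := ⟨0, fun a m => by simp⟩

/-- `M` is projective: every morphism from `M` lifts along every strict epimorphism. A morphism is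
an epimorphism when its range is dense. -/
def IsProjective (M : BanMod 𝒞 A) : Prop :=
  ∀ (N T : BanMod 𝒞 A) (p : BanHom N T), DenseRange p → p.IsStrict →
    ∀ f : BanHom M T, ∃ g : BanHom M N, p.comp g = f

theorem smul_bound (M : BanMod 𝒞 A) : ∃ C : ℝ, 0 ≤ C ∧ ∀ (a : A) (m : M),
    ‖a • m‖ ≤ C * ‖a‖ * ‖m‖ := by
  obtain ⟨C, hC⟩ := M.exists_smul_bound
  refine ⟨max C 0, le_max_right _ _, fun a x => (hC a x).trans ?_⟩
  gcongr
  exact le_max_left _ _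

/-! ### Finite products -/

/-- The product of a finite family, with the supremum norm. -/
noncomputable def pi {ι : Type} [Finite ι] (M : ι → BanMod 𝒞 A) : BanMod 𝒞 A :=
  letI := Fintype.ofFinite ι
  { carrier := ∀ i, M i
    kind := ⟨fun h => by
      have : ∀ i, IsUltrametricDist (M i) := fun i => (M i).kind.ultra h
      infer_instance⟩
    exists_smul_bound := by
      choose C hC0 hC using fun i => (M i).smul_bound
      refine ⟨∑ i, C i, fun a m => ?_⟩
      rw [pi_norm_le_iff_of_nonneg (by
        have := Finset.sum_nonneg fun i (_ : i ∈ Finset.univ) => hC0 i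
        positivity)]
      intro i
      refine (hC i a (m i)).trans ?_
      have h1 : C i ≤ ∑ i, C i :=
        Finset.single_le_sum (f := C) (fun i _ => hC0 i) (Finset.mem_univ i)
      have h2 : ‖m i‖ ≤ ‖m‖ := norm_le_pi_norm m i
      have h3 := hC0 i
      have h4 : 0 ≤ ∑ i, C i := h3.trans h1
      gcongr }

/-- The projection of a finite product to a factor. -/
noncomputable def proj {ι : Type} [Finite ι] (M : ι → BanMod 𝒞 A) (i : ι) :
    BanHom (pi M) (M i) where
  toFun x := x i
  map_add' _ _ := rfl
  map_smul' _ _ := rfl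
  exists_bound := ⟨1, fun x => by
    let _ := Fintype.ofFinite ι
    rw [one_mul]
    exact norm_le_pi_norm (G := fun i => M i) x i⟩

/-- The morphism to a finite product with given components. -/
noncomputable def piLift {ι : Type} [Finite ι] {N : BanMod 𝒞 A} {M : ι → BanMod 𝒞 A}
    (f : ∀ i, BanHom N (M i)) : BanHom N (pi M) where
  toFun x i := f i x
  map_add' x y := funext fun i => map_add (f i) x y
  map_smul' a x := funext fun i => map_smul (f i) a x
  exists_bound := by
    let _ := Fintype.ofFinite ι
    choose C hC0 hC using fun i => (f i).bound
    refine ⟨∑ i, C i, fun x => ?_⟩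
    refine (pi_norm_le_iff_of_nonneg (G := fun i => M i) (by
        have := Finset.sum_nonneg fun i (_ : i ∈ Finset.univ) => hC0 i
        positivity)).2 fun i => (hC i x).trans ?_
    have h1 : C i ≤ ∑ i, C i :=
      Finset.single_le_sum (f := C) (fun i _ => hC0 i) (Finset.mem_univ i)
    gcongr

theorem proj_comp_piLift {ι : Type} [Finite ι] {N : BanMod 𝒞 A} {M : ι → BanMod 𝒞 A}
    (f : ∀ i, BanHom N (M i)) (i : ι) : (proj M i).comp (piLift f) = f i := rfl

theorem pi_hom_ext {ι : Type} [Finite ι] {N : BanMod 𝒞 A} {M : ι → BanMod 𝒞 A}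
    {f g : BanHom N (pi M)} (h : ∀ i, (proj M i).comp f = (proj M i).comp g) : f = g :=
  DFunLike.ext _ _ fun x => funext fun i => DFunLike.congr_fun (h i) x

end BanMod

/-! ### Completed tensor products -/

section Tensor

variable {𝒞 : BanachKind} {A : Type u} [BanachRing A]

/-- The cost of a finite family of pairs `(m, n)`: the sum (`arch`) or the maximum (`nonarch`) of
the numbers `‖m‖ * ‖n‖`. -/
noncomputable def tensorCost (𝒞 : BanachKind) {M N : Type u} [Norm M] [Norm N] :
    List (M × N) → ℝ
  | [] => 0
  | p :: l =>
    match 𝒞 with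
    | .arch => ‖p.1‖ * ‖p.2‖ + tensorCost .arch l
    | .nonarch => max (‖p.1‖ * ‖p.2‖) (tensorCost .nonarch l)

/-- The element `∑ m ⊗ n` represented by a finite family of pairs `(m, n)`. -/
def tensorEval {M N : BanMod 𝒞 A} (l : List (M × N)) : M ⊗[A] N :=
  (l.map fun p => p.1 ⊗ₜ[A] p.2).sum

/-- The tensor seminorm: the infimum of the costs of all representations. -/
noncomputable def tensorNorm {M N : BanMod 𝒞 A} (t : M ⊗[A] N) : ℝ :=
  sInf {c | ∃ l : List (M × N), tensorEval l = t ∧ tensorCost 𝒞 l = c}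

theorem tensorCost_nonneg {M N : Type u} [NormedAddCommGroup M] [NormedAddCommGroup N]
    (l : List (M × N)) : 0 ≤ tensorCost 𝒞 l := by
  induction l with
  | nil => cases 𝒞 <;> simp [tensorCost]
  | cons p l ih =>
    cases 𝒞
    · simp only [tensorCost]; positivity
    · simp only [tensorCost]; exact le_max_of_le_right ih

theorem tensorCost_append_le {M N : Type u} [NormedAddCommGroup M] [NormedAddCommGroup N]
    (l l' : List (M × N)) : tensorCost 𝒞 (l ++ l') ≤ tensorCost 𝒞 l + tensorCost 𝒞 l' := by
  induction l with
  | nil => cases 𝒞 <;> simp [tensorCost]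
  | cons p l ih =>
    cases 𝒞
    · simp only [tensorCost, List.cons_append]; linarith
    · simp only [tensorCost, List.cons_append]
      have h0 := tensorCost_nonneg (𝒞 := .nonarch) l'
      refine max_le ?_ (ih.trans ?_)
      · linarith [le_max_left (‖p.1‖ * ‖p.2‖) (tensorCost .nonarch l)]
      · linarith [le_max_right (‖p.1‖ * ‖p.2‖) (tensorCost .nonarch l)]

theorem tensorCost_append_le_max (h : 𝒞 = .nonarch) {M N : Type u} [NormedAddCommGroup M]
    [NormedAddCommGroup N] (l l' : List (M × N)) :
    tensorCost 𝒞 (l ++ l') ≤ max (tensorCost 𝒞 l) (tensorCost 𝒞 l') := by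
  subst h
  induction l with
  | nil => simp [tensorCost]
  | cons p l ih =>
    simp only [tensorCost, List.cons_append, max_assoc]
    exact max_le_max le_rfl ih

/-- If `‖φ p‖ ≤ C * ‖p.1‖ * ‖p.2‖` for all pairs, with values in a group of the right kind, then
the norm of the sum is at most `C` times the cost. -/
theorem norm_sum_le_tensorCost {M N T : Type u} [NormedAddCommGroup M] [NormedAddCommGroup N]
    [NormedAddCommGroup T] [hT : IsOfKind 𝒞 T] (φ : M × N → T) {C : ℝ} (hC : 0 ≤ C)
    (hφ : ∀ p, ‖φ p‖ ≤ C * (‖p.1‖ * ‖p.2‖)) (l : List (M × N)) :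
    ‖(l.map φ).sum‖ ≤ C * tensorCost 𝒞 l := by
  induction l with
  | nil => cases 𝒞 <;> simp [tensorCost]
  | cons p l ih =>
    rw [List.map_cons, List.sum_cons]
    cases 𝒞
    · simp only [tensorCost, mul_add]
      exact (norm_add_le _ _).trans (add_le_add (hφ p) ih)
    · have := hT.ultra rfl
      simp only [tensorCost, mul_max_of_nonneg _ _ hC]
      exact (IsUltrametricDist.norm_add_le_max _ _).trans (max_le_max (hφ p) ih)

variable {M N T : BanMod 𝒞 A}

theorem tensorEval_append (l l' : List (M × N)) :
    tensorEval (l ++ l') = tensorEval l + tensorEval l' := by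
  simp [tensorEval]

theorem exists_tensorEval (t : M ⊗[A] N) : ∃ l : List (M × N), tensorEval l = t := by
  induction t with
  | zero => exact ⟨[], by simp [tensorEval]⟩
  | tmul m n => exact ⟨[(m, n)], by simp [tensorEval]⟩
  | add x y hx hy =>
    obtain ⟨l, rfl⟩ := hx
    obtain ⟨l', rfl⟩ := hy
    exact ⟨l ++ l', tensorEval_append l l'⟩

theorem tensorNorm_le (l : List (M × N)) : tensorNorm (tensorEval l) ≤ tensorCost 𝒞 l :=
  csInf_le ⟨0, by rintro _ ⟨l, -, rfl⟩; exact tensorCost_nonneg l⟩ ⟨l, rfl, rfl⟩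

theorem le_tensorNorm {t : M ⊗[A] N} {c : ℝ}
    (h : ∀ l : List (M × N), tensorEval l = t → c ≤ tensorCost 𝒞 l) : c ≤ tensorNorm t := by
  obtain ⟨l, hl⟩ := exists_tensorEval t
  refine le_csInf ⟨_, l, hl, rfl⟩ ?_
  rintro _ ⟨l, hl, rfl⟩
  exact h l hl

theorem exists_tensorCost_lt (t : M ⊗[A] N) {c : ℝ} (h : tensorNorm t < c) :
    ∃ l : List (M × N), tensorEval l = t ∧ tensorCost 𝒞 l < c := by
  by_contra! hc
  exact absurd (le_tensorNorm hc) (not_le.2 h)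

theorem tensorNorm_nonneg (t : M ⊗[A] N) : 0 ≤ tensorNorm t :=
  le_tensorNorm fun l _ => tensorCost_nonneg l

theorem tensorNorm_zero : tensorNorm (0 : M ⊗[A] N) = 0 := by
  refine le_antisymm ?_ (tensorNorm_nonneg _)
  have h := tensorNorm_le (𝒞 := 𝒞) (M := M) (N := N) []
  have h0 : tensorCost 𝒞 ([] : List (M × N)) = 0 := by cases 𝒞 <;> rfl
  rw [h0] at h
  simpa [tensorEval] using h

theorem tensorNorm_add_le (s t : M ⊗[A] N) :
    tensorNorm (s + t) ≤ tensorNorm s + tensorNorm t := by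
  refine le_of_forall_pos_le_add fun ε hε => ?_
  obtain ⟨l, rfl, hl⟩ := exists_tensorCost_lt s (c := tensorNorm s + ε / 2) (by linarith)
  obtain ⟨l', rfl, hl'⟩ := exists_tensorCost_lt t (c := tensorNorm t + ε / 2) (by linarith)
  rw [← tensorEval_append]
  refine (tensorNorm_le _).trans ((tensorCost_append_le l l').trans ?_)
  linarith

theorem tensorNorm_add_le_max (h : 𝒞 = .nonarch) (s t : M ⊗[A] N) :
    tensorNorm (s + t) ≤ max (tensorNorm s) (tensorNorm t) := by
  refine le_of_forall_pos_le_add fun ε hε => ?_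
  obtain ⟨l, rfl, hl⟩ := exists_tensorCost_lt s (c := tensorNorm s + ε) (by linarith)
  obtain ⟨l', rfl, hl'⟩ := exists_tensorCost_lt t (c := tensorNorm t + ε) (by linarith)
  rw [← tensorEval_append, ← max_add_add_right]
  exact (tensorNorm_le _).trans ((tensorCost_append_le_max h l l').trans (max_le_max hl.le hl'.le))

/-- A linear map out of the algebraic tensor product which is bounded on pure tensors is bounded
for the tensor seminorm. -/
theorem norm_le_tensorNorm {T : Type u} [NormedAddCommGroup T] [IsOfKind 𝒞 T]
    (f : M ⊗[A] N →+ T) {C : ℝ} (hC : 0 ≤ C)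
    (hf : ∀ m n, ‖f (m ⊗ₜ n)‖ ≤ C * (‖m‖ * ‖n‖)) (t : M ⊗[A] N) : ‖f t‖ ≤ C * tensorNorm t := by
  refine le_of_forall_pos_le_add fun ε hε => ?_
  obtain ⟨l, rfl, hl⟩ := exists_tensorCost_lt t (c := tensorNorm t + ε / (C + 1))
    (lt_add_of_pos_right _ (by positivity))
  have h1 : f (tensorEval l) = (l.map fun p => f (p.1 ⊗ₜ p.2)).sum := by
    rw [tensorEval, map_list_sum, List.map_map]; rfl
  have h2 := norm_sum_le_tensorCost (𝒞 := 𝒞) (fun p : M × N => f (p.1 ⊗ₜ p.2)) hC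
    (fun p => hf p.1 p.2) l
  have h3 : C * (ε / (C + 1)) ≤ ε := by
    rw [mul_div_assoc', div_le_iff₀ (by positivity)]; nlinarith
  have h4 := mul_le_mul_of_nonneg_left hl.le hC
  rw [h1]
  refine h2.trans (h4.trans ?_)
  rw [mul_add]
  linarith

theorem tensorNorm_smul_le_of (g : M ⊗[A] N →+ M ⊗[A] N) (φ : M × N → M × N)
    (hg : ∀ p : M × N, g (p.1 ⊗ₜ p.2) = (φ p).1 ⊗ₜ (φ p).2) {C : ℝ} (hC : 0 ≤ C)
    (hφ : ∀ p, ‖(φ p).1‖ * ‖(φ p).2‖ ≤ C * (‖p.1‖ * ‖p.2‖)) (t : M ⊗[A] N) :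
    tensorNorm (g t) ≤ C * tensorNorm t := by
  have key : ∀ l : List (M × N), g (tensorEval l) = tensorEval (l.map φ) ∧
      tensorCost 𝒞 (l.map φ) ≤ C * tensorCost 𝒞 l := by
    intro l
    constructor
    · rw [tensorEval, map_list_sum, tensorEval, List.map_map, List.map_map]
      congr 1
      exact List.map_congr_left fun p _ => hg p
    · induction l with
      | nil => cases 𝒞 <;> simp [tensorCost]
      | cons p l ih =>
        cases 𝒞
        · simp only [tensorCost, List.map_cons, mul_add]; exact add_le_add (hφ p) ih
        · simp only [tensorCost, List.map_cons, mul_max_of_nonneg _ _ hC]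
          exact max_le_max (hφ p) ih
  refine le_of_forall_pos_le_add fun ε hε => ?_
  obtain ⟨l, rfl, hl⟩ := exists_tensorCost_lt t (c := tensorNorm t + ε / (C + 1))
    (lt_add_of_pos_right _ (by positivity))
  have h3 : C * (ε / (C + 1)) ≤ ε := by
    rw [mul_div_assoc', div_le_iff₀ (by positivity)]; nlinarith
  have h4 := mul_le_mul_of_nonneg_left hl.le hC
  rw [(key l).1]
  refine (tensorNorm_le _).trans ((key l).2.trans (h4.trans ?_))
  rw [mul_add]
  linarith

theorem tensorNorm_neg (t : M ⊗[A] N) : tensorNorm (-t) = tensorNorm t := by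
  have h : ∀ t : M ⊗[A] N, tensorNorm (-t) ≤ tensorNorm t := fun t => by
    have := tensorNorm_smul_le_of (C := 1) (-AddMonoidHom.id (M ⊗[A] N)) (fun p => (-p.1, p.2))
      (fun p => (TensorProduct.neg_tmul _ _).symm) zero_le_one (fun p => by simp) t
    simpa using this
  exact le_antisymm (h t) (by simpa using h (-t))

theorem exists_tensorNorm_smul_bound : ∃ C : ℝ, 0 ≤ C ∧ ∀ (a : A) (t : M ⊗[A] N),
    tensorNorm (a • t) ≤ C * ‖a‖ * tensorNorm t := by
  obtain ⟨C, hC, h⟩ := M.smul_bound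
  refine ⟨C, hC, fun a t => ?_⟩
  refine tensorNorm_smul_le_of (DistribSMul.toAddMonoidHom (M ⊗[A] N) a) (fun p => (a • p.1, p.2))
    (fun p => (TensorProduct.smul_tmul' _ _ _).symm) (by positivity) (fun p => ?_) t
  rw [← mul_assoc]
  exact mul_le_mul_of_nonneg_right (h a p.1) (norm_nonneg _)

/-- The algebraic tensor product over `A`, carrying the tensor seminorm. -/
def PreTensor (M N : BanMod 𝒞 A) : Type u := M ⊗[A] N

noncomputable instance : AddCommGroup (PreTensor M N) :=
  inferInstanceAs (AddCommGroup (M ⊗[A] N))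

noncomputable instance : Module A (PreTensor M N) :=
  inferInstanceAs (Module A (M ⊗[A] N))

noncomputable instance : SeminormedAddCommGroup (PreTensor M N) :=
  AddGroupSeminorm.toSeminormedAddCommGroup
    { toFun := fun t => tensorNorm (𝒞 := 𝒞) (M := M) (N := N) t
      map_zero' := tensorNorm_zero
      neg' := tensorNorm_neg
      add_le' := tensorNorm_add_le }

theorem PreTensor.norm_def (t : PreTensor M N) :
    ‖t‖ = tensorNorm (𝒞 := 𝒞) (M := M) (N := N) t := rfl

instance : UniformContinuousConstSMul A (PreTensor M N) where
  uniformContinuous_const_smul a := by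
    obtain ⟨C, hC, h⟩ := exists_tensorNorm_smul_bound (M := M) (N := N)
    refine (LipschitzWith.of_dist_le_mul (K := (C * ‖a‖).toNNReal) fun x y => ?_).uniformContinuous
    rw [dist_eq_norm, dist_eq_norm, ← smul_sub, Real.coe_toNNReal _ (by positivity)]
    exact h a (x - y)

/-- The identity map, from `PreTensor` to the algebraic tensor product. -/
noncomputable def PreTensor.out (M N : BanMod 𝒞 A) : PreTensor M N →ₗ[A] M ⊗[A] N where
  toFun t := t
  map_add' _ _ := rfl
  map_smul' _ _ := rfl

theorem PreTensor.norm_smul_bound (M N : BanMod 𝒞 A) : ∃ C : ℝ, ∀ (a : A) (t : PreTensor M N),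
    ‖a • t‖ ≤ C * ‖a‖ * ‖t‖ := by
  obtain ⟨C, hC, h⟩ := exists_tensorNorm_smul_bound (M := M) (N := N)
  exact ⟨C, h⟩

theorem PreTensor.norm_add_le_max (h : 𝒞 = .nonarch) (s t : PreTensor M N) :
    ‖s + t‖ ≤ max ‖s‖ ‖t‖ :=
  tensorNorm_add_le_max h s t

theorem completion_isUltrametricDist {E : Type u} [SeminormedAddCommGroup E]
    (h : ∀ s t : E, ‖s + t‖ ≤ max ‖s‖ ‖t‖) :
    IsUltrametricDist (UniformSpace.Completion E) := by
  refine IsUltrametricDist.isUltrametricDist_of_forall_norm_add_le_max_norm fun x y => ?_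
  refine UniformSpace.Completion.induction_on₂ x y
    (isClosed_le (by fun_prop) (by fun_prop)) fun s t => ?_
  rw [← UniformSpace.Completion.coe_add]
  simp only [UniformSpace.Completion.norm_coe]
  exact h s t

theorem completion_norm_smul_le {E : Type u} [SeminormedAddCommGroup E] [Module A E]
    [UniformContinuousConstSMul A E] {C : ℝ} (h : ∀ (a : A) (t : E), ‖a • t‖ ≤ C * ‖a‖ * ‖t‖)
    (a : A) (x : UniformSpace.Completion E) : ‖a • x‖ ≤ C * ‖a‖ * ‖x‖ := by
  refine UniformSpace.Completion.induction_on x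
    (isClosed_le ((continuous_const_smul a).norm) (continuous_const.mul continuous_norm))
    fun t => ?_
  rw [← UniformSpace.Completion.coe_smul]
  simp only [UniformSpace.Completion.norm_coe]
  exact h a t

/-- The completed tensor product `M ⊗̂_A N`: the completion of `M ⊗_A N` for the tensor
seminorm. -/
noncomputable def BanMod.tensor (M N : BanMod 𝒞 A) : BanMod 𝒞 A where
  carrier := UniformSpace.Completion (PreTensor M N)
  kind := ⟨fun h => completion_isUltrametricDist (PreTensor.norm_add_le_max h)⟩
  exists_smul_bound :=
    let ⟨C, hC⟩ := PreTensor.norm_smul_bound M N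
    ⟨C, completion_norm_smul_le hC⟩

/-- The canonical map from the algebraic to the completed tensor product. -/
noncomputable def BanMod.tensorMk (M N : BanMod 𝒞 A) : M ⊗[A] N →ₗ[A] M.tensor N where
  toFun t := UniformSpace.Completion.coe' (show PreTensor M N from t)
  map_add' s t := UniformSpace.Completion.coe_add (show PreTensor M N from s)
    (show PreTensor M N from t)
  map_smul' a t := UniformSpace.Completion.coe_smul a (show PreTensor M N from t)

/-- The canonical bounded bilinear map `(m, n) ↦ m ⊗ n` to the completed tensor product. -/
noncomputable def BanMod.tmul (M N : BanMod 𝒞 A) : M →ₗ[A] N →ₗ[A] M.tensor N :=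
  (TensorProduct.mk A M N).compr₂ (M.tensorMk N)

theorem BanMod.norm_tmul_le (m : M) (n : N) : ‖M.tmul N m n‖ ≤ ‖m‖ * ‖n‖ := by
  have h1 : ‖M.tmul N m n‖ = tensorNorm (m ⊗ₜ[A] n) :=
    UniformSpace.Completion.norm_coe (E := PreTensor M N) _
  have h2 := tensorNorm_le (𝒞 := 𝒞) [(m, n)]
  have h3 : tensorCost 𝒞 [(m, n)] = ‖m‖ * ‖n‖ := by
    cases 𝒞
    · simp [tensorCost]
    · simp only [tensorCost]; exact max_eq_left (by positivity)
  rw [h1, ← h3]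
  simpa [tensorEval] using h2

theorem completion_exists_lift {E : Type u} [SeminormedAddCommGroup E] [Module A E]
    [UniformContinuousConstSMul A E] (T : BanMod 𝒞 A) (f : E →ₗ[A] T) {C : ℝ} (hC : 0 ≤ C)
    (hf : ∀ x, ‖f x‖ ≤ C * ‖x‖) :
    ∃ g : UniformSpace.Completion E →ₗ[A] T, (∀ x : E, g x = f x) ∧ ∀ x, ‖g x‖ ≤ C * ‖x‖ := by
  have hu : UniformContinuous f := by
    refine (LipschitzWith.of_dist_le_mul (K := C.toNNReal) fun x y => ?_).uniformContinuous
    rw [dist_eq_norm, dist_eq_norm, ← map_sub, Real.coe_toNNReal _ hC]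
    exact hf _
  have hc : Continuous (UniformSpace.Completion.extension f) :=
    UniformSpace.Completion.continuous_extension
  have hs : ∀ a : A, Continuous fun x : T => a • x := by
    intro a
    obtain ⟨D, hD, h⟩ := T.smul_bound
    refine (LipschitzWith.of_dist_le_mul (K := (D * ‖a‖).toNNReal) fun x y => ?_).continuous
    rw [dist_eq_norm, dist_eq_norm, ← smul_sub, Real.coe_toNNReal _ (by positivity)]
    exact h a (x - y)
  have he : ∀ x : E, UniformSpace.Completion.extension f (x : UniformSpace.Completion E) = f x :=
    UniformSpace.Completion.extension_coe hu
  refine ⟨{ toFun := UniformSpace.Completion.extension f, map_add' := ?_, map_smul' := ?_ },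
    he, ?_⟩
  · intro x y
    refine UniformSpace.Completion.induction_on₂ x y
      (isClosed_eq (by fun_prop) (by fun_prop)) fun s t => ?_
    rw [← UniformSpace.Completion.coe_add, he, he, he, map_add]
  · intro a x
    refine UniformSpace.Completion.induction_on x
      (isClosed_eq (hc.comp (continuous_const_smul a)) ((hs a).comp hc)) fun t => ?_
    rw [← UniformSpace.Completion.coe_smul, he, he, map_smul]
    rfl
  · intro x
    refine UniformSpace.Completion.induction_on x
      (isClosed_le hc.norm (continuous_const.mul continuous_norm)) fun t => ?_
    change ‖UniformSpace.Completion.extension f _‖ ≤ _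
    rw [he, UniformSpace.Completion.norm_coe]
    exact hf t

theorem BanMod.exists_tensorLift (β : M →ₗ[A] N →ₗ[A] T)
    (hβ : ∃ C : ℝ, ∀ m n, ‖β m n‖ ≤ C * (‖m‖ * ‖n‖)) :
    ∃ g : BanHom (M.tensor N) T, ∀ m n, g (M.tmul N m n) = β m n := by
  obtain ⟨C, hC⟩ := hβ
  have hC' : ∀ m n, ‖β m n‖ ≤ max C 0 * (‖m‖ * ‖n‖) := fun m n => (hC m n).trans (by
    gcongr
    exact le_max_left _ _)
  obtain ⟨g, hg, hb⟩ := completion_exists_lift (E := PreTensor M N) T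
    (TensorProduct.lift β ∘ₗ PreTensor.out M N) (le_max_right C 0)
    (fun t => norm_le_tensorNorm (TensorProduct.lift β).toAddMonoidHom (le_max_right C 0) (fun m n => by simpa using hC' m n) t)
  exact ⟨⟨g, _, hb⟩, fun m n => (hg _).trans (TensorProduct.lift.tmul m n)⟩

/-- The morphism `M ⊗̂ N → T` induced by a bounded bilinear map. -/
noncomputable def BanMod.tensorLift (β : M →ₗ[A] N →ₗ[A] T)
    (hβ : ∃ C : ℝ, ∀ m n, ‖β m n‖ ≤ C * (‖m‖ * ‖n‖)) : BanHom (M.tensor N) T :=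
  (BanMod.exists_tensorLift β hβ).choose

theorem BanMod.tensorLift_tmul (β : M →ₗ[A] N →ₗ[A] T)
    (hβ : ∃ C : ℝ, ∀ m n, ‖β m n‖ ≤ C * (‖m‖ * ‖n‖)) (m : M) (n : N) :
    BanMod.tensorLift β hβ (M.tmul N m n) = β m n :=
  (BanMod.exists_tensorLift β hβ).choose_spec m n

/-- Two morphisms out of a completed tensor product agree if they agree on pure tensors, so
`tensorLift` is the only morphism with the stated values on pure tensors. -/
theorem BanMod.tensor_hom_ext {f g : BanHom (M.tensor N) T}
    (h : ∀ m n, f (M.tmul N m n) = g (M.tmul N m n)) : f = g := by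
  have hc : ∀ f : BanHom (M.tensor N) T, Continuous f := fun f => by
    obtain ⟨C, hC, hf⟩ := f.bound
    refine (LipschitzWith.of_dist_le_mul (K := C.toNNReal) fun x y => ?_).continuous
    rw [dist_eq_norm, dist_eq_norm, ← map_sub, Real.coe_toNNReal _ hC]
    exact hf _
  refine DFunLike.ext _ _ fun x => ?_
  refine UniformSpace.Completion.induction_on (α := PreTensor M N) x
    (isClosed_eq (hc f) (hc g)) fun t => ?_
  suffices H : ∀ t : M ⊗[A] N, f (M.tensorMk N t) = g (M.tensorMk N t) from H t
  intro t
  induction t with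
  | zero => rw [map_zero, map_zero, map_zero]
  | tmul m n => exact h m n
  | add s t hs ht => rw [map_add, map_add, map_add, hs, ht]

variable {M' N' : BanMod 𝒞 A}

/-- The morphism `f ⊗̂ g`, with `(f ⊗̂ g) (m ⊗ n) = f m ⊗ g n`. -/
noncomputable def BanHom.tensorMap (f : BanHom M M') (g : BanHom N N') :
    BanHom (M.tensor N) (M'.tensor N') :=
  BanMod.tensorLift ((M'.tmul N').compl₁₂ f.toLinearMap g.toLinearMap) (by
    obtain ⟨C, hC, hf⟩ := f.bound
    obtain ⟨D, hD, hg⟩ := g.bound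
    refine ⟨C * D, fun m n => (BanMod.norm_tmul_le (f m) (g n)).trans ?_⟩
    calc ‖f m‖ * ‖g n‖ ≤ (C * ‖m‖) * (D * ‖n‖) := by
          gcongr
          · exact hf m
          · exact hg n
      _ = C * D * (‖m‖ * ‖n‖) := by ring)

theorem BanHom.tensorMap_tmul (f : BanHom M M') (g : BanHom N N') (m : M) (n : N) :
    f.tensorMap g (M.tmul N m n) = M'.tmul N' (f m) (g n) :=
  BanMod.tensorLift_tmul _ _ m n

theorem BanHom.tensorMap_comp {M'' N'' : BanMod 𝒞 A} (f : BanHom M M') (g : BanHom N N')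
    (f' : BanHom M' M'') (g' : BanHom N' N'') :
    (f'.tensorMap g').comp (f.tensorMap g) = (f'.comp f).tensorMap (g'.comp g) :=
  BanMod.tensor_hom_ext fun m n => by
    simp only [BanHom.comp_apply, BanHom.tensorMap_tmul]

theorem BanHom.zero_tensorMap (g : BanHom N N') :
    (0 : BanHom M M').tensorMap g = 0 :=
  BanMod.tensor_hom_ext fun m n => by
    simp only [BanHom.tensorMap_tmul, BanHom.zero_apply, map_zero, LinearMap.zero_apply]

theorem BanHom.tensorMap_zero (f : BanHom M M') :
    f.tensorMap (0 : BanHom N N') = 0 :=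
  BanMod.tensor_hom_ext fun m n => by
    simp only [BanHom.tensorMap_tmul, BanHom.zero_apply, map_zero]

/-- The morphism `N → M ⊗̂ N`, `n ↦ m ⊗ n`. -/
noncomputable def BanMod.tmulLeft (m : M) (N : BanMod 𝒞 A) : BanHom N (M.tensor N) where
  toLinearMap := M.tmul N m
  exists_bound := ⟨‖m‖, fun n => BanMod.norm_tmul_le m n⟩

end Tensor

/-! ### Chain complexes -/

/-- Chain complexes `⋯ → X 2 → X 1 → X 0 → 0` of `Mod_𝒞(A)` in non-negative homological degrees. -/
structure BanComplex (𝒞 : BanachKind) (A : Type u) [BanachRing A] where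
  X : ℕ → BanMod 𝒞 A
  d : ∀ n, BanHom (X (n + 1)) (X n)
  d_comp_d : ∀ n, (d n).comp (d (n + 1)) = 0

namespace BanComplex

variable {𝒞 : BanachKind} {A : Type u} [BanachRing A]

/-- The index set `{(i, j) | i + j = n}`. -/
abbrev TotIdx (n : ℕ) : Type := {p : ℕ × ℕ // p.1 + p.2 = n}

instance (n : ℕ) : Finite (TotIdx n) :=
  Set.Finite.to_subtype ((Finset.HasAntidiagonal.antidiagonal n).finite_toSet.subset
    fun p hp => by simpa using (show p.1 + p.2 = n from hp))

/-- The differential of the total complex of `P ⊗̂ Q`: its component of index `(i, j)` is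
`x ↦ (d ⊗ id) x_{i+1,j} + (-1)^i (id ⊗ d) x_{i,j+1}`. -/
noncomputable def totD (P Q : BanComplex 𝒞 A) (n : ℕ) :
    BanHom (BanMod.pi fun p : TotIdx (n + 1) => (P.X p.1.1).tensor (Q.X p.1.2))
      (BanMod.pi fun p : TotIdx n => (P.X p.1.1).tensor (Q.X p.1.2)) :=
  BanMod.piLift fun p =>
    ((P.d p.1.1).tensorMap (BanHom.id _)).comp
        (BanMod.proj (fun p : TotIdx (n + 1) => (P.X p.1.1).tensor (Q.X p.1.2))
          ⟨(p.1.1 + 1, p.1.2), by have := p.2; simp only; omega⟩) +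
      (-1 : ℤ) ^ p.1.1 • ((BanHom.id _).tensorMap (Q.d p.1.2)).comp
        (BanMod.proj (fun p : TotIdx (n + 1) => (P.X p.1.1).tensor (Q.X p.1.2))
          ⟨(p.1.1, p.1.2 + 1), by have := p.2; simp only; omega⟩)

theorem proj_comp_totD (P Q : BanComplex 𝒞 A) (n : ℕ) (p : TotIdx n) :
    (BanMod.proj (fun p : TotIdx n => (P.X p.1.1).tensor (Q.X p.1.2)) p).comp (totD P Q n) =
    ((P.d p.1.1).tensorMap (BanHom.id _)).comp
        (BanMod.proj (fun p : TotIdx (n + 1) => (P.X p.1.1).tensor (Q.X p.1.2))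
          ⟨(p.1.1 + 1, p.1.2), by have := p.2; simp only; omega⟩) +
      (-1 : ℤ) ^ p.1.1 • ((BanHom.id _).tensorMap (Q.d p.1.2)).comp
        (BanMod.proj (fun p : TotIdx (n + 1) => (P.X p.1.1).tensor (Q.X p.1.2))
          ⟨(p.1.1, p.1.2 + 1), by have := p.2; simp only; omega⟩) :=
  BanMod.proj_comp_piLift _ p

/-- The total complex `Tot(P ⊗̂ Q)`. -/
noncomputable def tot (P Q : BanComplex 𝒞 A) : BanComplex 𝒞 A where
  X n := BanMod.pi fun p : TotIdx n => (P.X p.1.1).tensor (Q.X p.1.2)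
  d n := totD P Q n
  d_comp_d n := by
    refine BanMod.pi_hom_ext fun p => ?_
    rw [← BanHom.comp_assoc, proj_comp_totD, BanHom.add_comp, BanHom.zsmul_comp,
      BanHom.comp_assoc, BanHom.comp_assoc, proj_comp_totD, proj_comp_totD]
    simp only [BanHom.comp_add, BanHom.comp_zsmul, ← BanHom.comp_assoc, BanHom.tensorMap_comp,
      P.d_comp_d, Q.d_comp_d, BanHom.zero_tensorMap, BanHom.tensorMap_zero, BanHom.zero_comp,
      BanHom.id_comp, BanHom.comp_id, zero_add, smul_zero, add_zero]
    rw [pow_succ, mul_neg_one, neg_smul, neg_add_cancel]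
    rfl

/-- The regular module as a complex concentrated in degree `0`. -/
def unit (𝒞 : BanachKind) (A : Type u) [BanachRing A] [IsOfKind 𝒞 A] : BanComplex 𝒞 A where
  X
    | 0 => BanMod.regular 𝒞 A
    | _ + 1 => BanMod.zero 𝒞 A
  d _ := 0
  d_comp_d _ := rfl

/-- The identity `X n → X m` for `n = m`. -/
def castX (K : BanComplex 𝒞 A) {n m : ℕ} (h : n = m) : BanHom (K.X n) (K.X m) :=
  h ▸ BanHom.id (K.X n)

/-- The chain map from `K` to the module `M` in degree `0` given by `ε : K_0 → M` is a
quasi-isomorphism, i.e. its mapping cone `⋯ → K_1 → K_0 → M → 0` is strictly exact. -/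
def IsQuasiIsoTo (K : BanComplex 𝒞 A) {M : BanMod 𝒞 A} (ε : BanHom (K.X 0) M) : Prop :=
  StrictExactAt ε (0 : BanHom M (BanMod.zero 𝒞 A)) ∧ StrictExactAt (K.d 0) ε ∧
    ∀ n, StrictExactAt (K.d (n + 1)) (K.d n)

end BanComplex

/-- A projective resolution of `M`. -/
structure BanResolution {𝒞 : BanachKind} {A : Type u} [BanachRing A] (M : BanMod 𝒞 A) where
  P : BanComplex 𝒞 A
  projective : ∀ n, (P.X n).IsProjective
  aug : BanHom (P.X 0) M
  quasiIso : P.IsQuasiIsoTo aug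

/-! ### Banach algebras -/

/-- Objects of `Alg_𝒞(A)`: commutative Banach `A`-algebras. -/
structure BanAlg (𝒞 : BanachKind) (A : Type u) [BanachRing A] where
  carrier : Type u
  [ring : BanachRing carrier]
  [algebra : Algebra A carrier]
  [kind : IsOfKind 𝒞 carrier]
  exists_smul_bound : ∃ C : ℝ, ∀ (a : A) (b : carrier), ‖a • b‖ ≤ C * ‖a‖ * ‖b‖

namespace BanAlg

variable {𝒞 : BanachKind} {A : Type u} [BanachRing A]

instance : CoeSort (BanAlg 𝒞 A) (Type u) := ⟨BanAlg.carrier⟩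

attribute [instance] BanAlg.ring BanAlg.algebra BanAlg.kind

/-- The underlying Banach module. -/
def toMod (B : BanAlg 𝒞 A) : BanMod 𝒞 A where
  carrier := B
  exists_smul_bound := B.exists_smul_bound

/-- The multiplication `B ⊗̂_A B → B`. -/
noncomputable def mul (B : BanAlg 𝒞 A) : BanHom (B.toMod.tensor B.toMod) B.toMod :=
  BanMod.tensorLift (M := B.toMod) (N := B.toMod) (T := B.toMod) (LinearMap.mul A B) (by
    obtain ⟨C, hC⟩ := BanachRing.exists_mul_bound (R := B)
    exact ⟨C, fun a b => (hC a b).trans_eq (mul_assoc _ _ _)⟩)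

/-- The structure morphism `A → B` is an epimorphism of Banach algebras. -/
def IsEpi (B : BanAlg 𝒞 A) : Prop :=
  ∀ (D : BanAlg 𝒞 A) (f g : B →ₐ[A] D),
    (∃ C : ℝ, ∀ b, ‖f b‖ ≤ C * ‖b‖) → (∃ C : ℝ, ∀ b, ‖g b‖ ≤ C * ‖b‖) →
    f.comp (Algebra.ofId A B) = g.comp (Algebra.ofId A B) → f = g

/-- For resolutions `P` and `Q` of the module underlying `B`, so that `Tot(P ⊗̂ Q)` represents
`B ⊗̂^𝕃 B`: the morphism `Tot(P ⊗̂ Q) → B ⊗̂ B → B` representing the multiplication, in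
degree `0`. -/
noncomputable def derivedMul (B : BanAlg 𝒞 A) (P Q : BanResolution B.toMod) :
    BanHom ((P.P.tot Q.P).X 0) B.toMod :=
  B.mul.comp ((P.aug.tensorMap Q.aug).comp
    (BanMod.proj (fun p : BanComplex.TotIdx 0 => (P.P.X p.1.1).tensor (Q.P.X p.1.2))
      ⟨(0, 0), rfl⟩))

/-- The structure morphism `A → B` is a homotopy epimorphism: the multiplication
`B ⊗̂_A^𝕃 B → B` is an isomorphism in the derived category, i.e. it is represented by a
quasi-isomorphism `Tot(P ⊗̂ Q) → B`, for any projective resolutions `P` and `Q` of `B`. -/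
def IsHomotopyEpi (B : BanAlg 𝒞 A) : Prop :=
  Nonempty (BanResolution B.toMod) ∧
    ∀ P Q : BanResolution B.toMod, (P.P.tot Q.P).IsQuasiIsoTo (B.derivedMul P Q)

/-- A projective resolution of the module underlying `B`, together with an element of degree `0`
over `1`. Such an element is the same as a lift `A → P` of the structure morphism `A → B`. -/
structure UnitalResolution (B : BanAlg 𝒞 A) extends BanResolution B.toMod where
  one : P.X 0
  aug_one : aug one = (1 : B)

end BanAlg

/-! ### Quotients by closed ideals -/

section Quotient

variable {R : Type u} [BanachRing R]

theorem quotient_norm_mul_bound (I : Ideal R) :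
    ∃ C : ℝ, ∀ a b : R ⧸ I, ‖a * b‖ ≤ C * ‖a‖ * ‖b‖ := by
  obtain ⟨C, hC⟩ := BanachRing.exists_mul_bound (R := R)
  refine ⟨max C 0, fun a b => ?_⟩
  have h : ∀ ε > 0, ‖a * b‖ ≤ max C 0 * (‖a‖ + ε) * (‖b‖ + ε) := fun ε hε => by
    obtain ⟨x, rfl, hx⟩ := Submodule.Quotient.norm_mk_lt a hε
    obtain ⟨y, rfl, hy⟩ := Submodule.Quotient.norm_mk_lt b hε
    refine (Submodule.Quotient.norm_mk_le I (x * y)).trans ((hC x y).trans ?_)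
    gcongr
    exact le_max_left _ _
  have hc : Filter.Tendsto (fun ε : ℝ => max C 0 * (‖a‖ + ε) * (‖b‖ + ε))
      (nhdsWithin 0 (Set.Ioi 0)) (nhds (max C 0 * (‖a‖ + 0) * (‖b‖ + 0))) :=
    (Continuous.tendsto (by fun_prop) 0).mono_left nhdsWithin_le_nhds
  rw [add_zero, add_zero] at hc
  exact ge_of_tendsto hc (Filter.eventually_of_mem self_mem_nhdsWithin h)

/-- The quotient of a Banach ring by a closed ideal, with the quotient norm. -/
noncomputable abbrev quotientBanachRing (I : Ideal R) (hI : IsClosed (I : Set R)) :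
    BanachRing (R ⧸ I) :=
  letI : NormedAddCommGroup (R ⧸ I) := @Submodule.Quotient.normedAddCommGroup R _ R _ _ I hI
  { (inferInstance : CommRing (R ⧸ I)), (inferInstance : NormedAddCommGroup (R ⧸ I)) with
    dist_eq_norm_sub := fun x y => dist_eq_norm x y
    complete := Submodule.Quotient.completeSpace I
    exists_mul_bound := quotient_norm_mul_bound I }

/-- The Banach `R`-algebra `R / I` for a closed ideal `I`. -/
noncomputable def BanAlg.quotient (𝒞 : BanachKind) [hR : IsOfKind 𝒞 R] (I : Ideal R)
    (hI : IsClosed (I : Set R)) : BanAlg 𝒞 R :=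
  letI := quotientBanachRing I hI
  { carrier := R ⧸ I
    kind := ⟨fun h => by
      have := hR.ultra h
      refine IsUltrametricDist.isUltrametricDist_of_forall_norm_add_le_max_norm fun a b => ?_
      refine le_of_forall_pos_le_add fun ε hε => ?_
      obtain ⟨x, rfl, hx⟩ := Submodule.Quotient.norm_mk_lt a hε
      obtain ⟨y, rfl, hy⟩ := Submodule.Quotient.norm_mk_lt b hε
      refine (Submodule.Quotient.norm_mk_le I (x + y)).trans ?_
      rw [← max_add_add_right]
      exact (IsUltrametricDist.norm_add_le_max x y).trans (max_le_max hx.le hy.le)⟩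
    exists_smul_bound := by
      obtain ⟨C, hC⟩ := quotient_norm_mul_bound I
      refine ⟨max C 0, fun a b => ?_⟩
      rw [Algebra.smul_def]
      refine (hC _ _).trans ?_
      gcongr
      · exact le_max_left _ _
      · exact Submodule.Quotient.norm_mk_le I a }

end Quotient

/-! ### Tate–Čech complexes and covers -/

section Cech

variable {𝒞 : BanachKind} {A : Type u} [BanachRing A] [IsOfKind 𝒞 A]

/-- The tensor product `M_{i_0} ⊗̂ (M_{i_1} ⊗̂ (⋯ ⊗̂ A))` along a list of indices; the empty tensor
product is `A`. -/
noncomputable def tensorList {ι : Type} (M : ι → BanMod 𝒞 A) : List ι → BanMod 𝒞 A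
  | [] => BanMod.regular 𝒞 A
  | i :: l => (M i).tensor (tensorList M l)

/-- The coface map which inserts the unit `e` at position `j`:
`x_0 ⊗ ⋯ ⊗ x_{j-1} ⊗ x_{j+1} ⊗ ⋯ ↦ x_0 ⊗ ⋯ ⊗ x_{j-1} ⊗ e ⊗ x_{j+1} ⊗ ⋯`. -/
noncomputable def coface {ι : Type} (M : ι → BanMod 𝒞 A) (e : ∀ i, M i) :
    ∀ (l : List ι) (j : ℕ), BanHom (tensorList M (l.eraseIdx j)) (tensorList M l)
  | [], _ => BanHom.id _
  | i :: l, 0 => BanMod.tmulLeft (e i) (tensorList M l)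
  | i :: l, j + 1 => (BanHom.id (M i)).tensorMap (coface M e l j)

/-- Strictly increasing tuples of length `p` in `{0, …, m - 1}`. -/
abbrev CechIdx (m p : ℕ) : Type :=
  {l : List (Fin m) // l.Pairwise (· < ·) ∧ l.length = p}

theorem finite_pairwise_lt (m : ℕ) : {l : List (Fin m) | l.Pairwise (· < ·)}.Finite := by
  refine (List.finite_length_le (Fin m) m).subset fun l hl => ?_
  have hl' : l.Pairwise (· < ·) := hl
  have hn : l.Nodup := hl'.imp fun h => ne_of_lt h
  simpa using hn.length_le_card

instance (m p : ℕ) : Finite (CechIdx m p) :=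
  Set.Finite.to_subtype ((finite_pairwise_lt m).subset fun _ h => h.1)

/-- The term of degree `p` of the Tate–Čech complex of the family `B`:
the product of the `B_{i_0} ⊗̂ ⋯ ⊗̂ B_{i_{p-1}}` over `i_0 < ⋯ < i_{p-1}`. -/
noncomputable def cechX {m : ℕ} (B : Fin m → BanAlg 𝒞 A) (p : ℕ) : BanMod 𝒞 A :=
  BanMod.pi fun l : CechIdx m p => tensorList (fun i => (B i).toMod) l.1

/-- The differential of the Tate–Čech complex: the alternating sum of the coface maps. -/
noncomputable def cechD {m : ℕ} (B : Fin m → BanAlg 𝒞 A) (p : ℕ) :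
    BanHom (cechX B p) (cechX B (p + 1)) :=
  BanMod.piLift fun l => ∑ j : Fin l.1.length, (-1 : ℤ) ^ (j : ℕ) •
    (coface (fun i => (B i).toMod) (fun i => (1 : B i)) l.1 j).comp
      (BanMod.proj (fun l : CechIdx m p => tensorList (fun i => (B i).toMod) l.1)
        ⟨l.1.eraseIdx j, l.2.1.sublist (List.eraseIdx_sublist _ _), by
          rw [List.length_eraseIdx_of_lt j.2, l.2.2, Nat.add_sub_cancel]⟩)

/-- Tate's acyclicity: the complex `0 → A → ∏ B_i → ∏ B_i ⊗̂ B_j → ⋯` is strictly exact. -/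
def TateAcyclic {m : ℕ} (B : Fin m → BanAlg 𝒞 A) : Prop :=
  StrictExactAt (0 : BanHom (BanMod.zero 𝒞 A) (cechX B 0)) (cechD B 0) ∧
    ∀ p, StrictExactAt (cechD B p) (cechD B (p + 1))

/-- The tensor product complex `Tot(P_{i_0} ⊗̂ (P_{i_1} ⊗̂ (⋯ ⊗̂ A)))` along a list of indices. -/
noncomputable def tensorListC {ι : Type} (P : ι → BanComplex 𝒞 A) : List ι → BanComplex 𝒞 A
  | [] => BanComplex.unit 𝒞 A
  | i :: l => (P i).tot (tensorListC P l)

/-- The coface map which inserts the degree `0` element `e` at position `j`, in degree `q`. -/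
noncomputable def cofaceC {ι : Type} (P : ι → BanComplex 𝒞 A) (e : ∀ i, (P i).X 0) :
    ∀ (l : List ι) (j q : ℕ), BanHom ((tensorListC P (l.eraseIdx j)).X q) ((tensorListC P l).X q)
  | [], _, _ => BanHom.id _
  | i :: l, 0, q => BanMod.piLift fun p : BanComplex.TotIdx q =>
      match p with
      | ⟨(0, b), h⟩ => (BanMod.tmulLeft (e i) ((tensorListC P l).X b)).comp
          ((tensorListC P l).castX (by rw [← h]; exact Nat.zero_add b))
      | ⟨(_ + 1, _), _⟩ => 0
  | i :: l, j + 1, q => BanMod.piLift fun p : BanComplex.TotIdx q =>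
      ((BanHom.id ((P i).X p.1.1)).tensorMap (cofaceC P e l j p.1.2)).comp
        (BanMod.proj (fun p : BanComplex.TotIdx q =>
          ((P i).X p.1.1).tensor ((tensorListC P (l.eraseIdx j)).X p.1.2)) p)

/-- Indices of the terms of total degree `n` of the derived Tate–Čech complex: a strictly increasing
tuple `l` (Čech degree `length l`) and a homological degree `q` with `length l - q = n`. -/
abbrev DerivedCechIdx (m : ℕ) (n : ℤ) : Type :=
  {x : List (Fin m) × ℕ // x.1.Pairwise (· < ·) ∧ (x.1.length : ℤ) - x.2 = n}

instance (m : ℕ) (n : ℤ) : Finite (DerivedCechIdx m n) :=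
  have := (finite_pairwise_lt m).to_subtype
  Finite.of_injective
    (fun x : DerivedCechIdx m n =>
      (⟨x.1.1, x.2.1⟩ : {l : List (Fin m) | l.Pairwise (· < ·)})) fun x y h => by
    have h1 : x.1.1 = y.1.1 := congrArg Subtype.val h
    have h2 := x.2.2
    have h3 := y.2.2
    rw [h1] at h2
    exact Subtype.ext (Prod.ext h1 (by omega))

/-- The term of degree `n` of the total complex of the derived Tate–Čech complex. -/
noncomputable def derivedCechX {m : ℕ} (P : Fin m → BanComplex 𝒞 A) (n : ℤ) : BanMod 𝒞 A :=
  BanMod.pi fun x : DerivedCechIdx m n => (tensorListC P x.1.1).X x.1.2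

/-- The differential of the total complex of the derived Tate–Čech complex: the alternating sum of
the coface maps plus `(-1)^p` times the differential of the tensor product complexes in
Čech degree `p`. -/
noncomputable def derivedCechD {m : ℕ} (P : Fin m → BanComplex 𝒞 A) (e : ∀ i, (P i).X 0) (n : ℤ) :
    BanHom (derivedCechX P n) (derivedCechX P (n + 1)) :=
  BanMod.piLift fun y =>
    ∑ j : Fin y.1.1.length, (-1 : ℤ) ^ (j : ℕ) • (cofaceC P e y.1.1 j y.1.2).comp
      (BanMod.proj (fun x : DerivedCechIdx m n => (tensorListC P x.1.1).X x.1.2)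
        ⟨(y.1.1.eraseIdx j, y.1.2), y.2.1.sublist (List.eraseIdx_sublist _ _), by
          have h1 := y.2.2
          have h2 := j.2
          simp only [List.length_eraseIdx_of_lt h2]
          omega⟩) +
    (-1 : ℤ) ^ y.1.1.length • ((tensorListC P y.1.1).d y.1.2).comp
      (BanMod.proj (fun x : DerivedCechIdx m n => (tensorListC P x.1.1).X x.1.2)
        ⟨(y.1.1, y.1.2 + 1), y.2.1, by
          have h1 := y.2.2
          push_cast
          omega⟩)

/-- Derived Tate's acyclicity: the total complex of
`0 → A → ∏ B_i → ∏ B_i ⊗̂^𝕃 B_j → ⋯` is strictly exact, the derived tensor products being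
computed by any projective resolutions of the `B_i` and any lifts of the structure morphisms. -/
def DerivedTateAcyclic {m : ℕ} (B : Fin m → BanAlg 𝒞 A) : Prop :=
  (∀ i, Nonempty (B i).UnitalResolution) ∧
    ∀ P : ∀ i, (B i).UnitalResolution, ∀ n : ℤ,
      StrictExactAt (derivedCechD (fun i => (P i).P) (fun i => (P i).one) n)
        (derivedCechD (fun i => (P i).P) (fun i => (P i).one) (n + 1))

/-- A set `S` of Banach `A`-algebras is a derived cover of `A`. The finite subset of `S` is given by
an enumeration `B` without repetitions. -/
def IsDerivedCover (S : Set (BanAlg 𝒞 A)) : Prop :=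
  (∀ B ∈ S, B.IsHomotopyEpi) ∧
    ∃ (m : ℕ) (B : Fin m → BanAlg 𝒞 A), Function.Injective B ∧ (∀ i, B i ∈ S) ∧
      DerivedTateAcyclic B

/-- A set `S` of Banach `A`-algebras is a non-derived cover of `A`. -/
def IsNonDerivedCover (S : Set (BanAlg 𝒞 A)) : Prop :=
  (∀ B ∈ S, B.IsEpi) ∧
    ∃ (m : ℕ) (B : Fin m → BanAlg 𝒞 A), Function.Injective B ∧ (∀ i, B i ∈ S) ∧ TateAcyclic B

end Cech

/-! For an idempotent `e`, multiplication by `1 - e` splits `R → R/eR`, so `B = R/eR` is a direct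
summand of `R`, hence projective, and `B ⊗̂ B ≅ B` because `R → B` is surjective. A resolution of a
projective module is contractible over that module, and contractions are compatible with tensor
products, so derived tensor products of such quotients agree with the completed tensor products.

If idempotents `e_i` have product zero, then the weights `(∏_{k < i} e_k) (1 - e_i)` sum to `1` and
factor through `R/e_i R`. Contracting the first tensor factor with them, as with a partition of
unity, gives a contracting homotopy of the Tate–Čech complex. On the derived complex this homotopy
and the contractions of the columns assemble to an operator `h` such that `x - d (h x)` vanishes in
one more Čech degree each time it is applied to a cocycle `x`. As there are only finitely many Čech
degrees, every cocycle is a coboundary.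
-/

/-! ### Strict exactness and lifting -/

section StrictExactness

variable {𝒞 : BanachKind} {A : Type u} [BanachRing A] {M N T : BanMod 𝒞 A}

namespace BanHom

@[ext]
theorem ext {f g : BanHom M N} (h : ∀ x, f x = g x) : f = g := DFunLike.ext _ _ h

theorem continuous (f : BanHom M N) : Continuous f :=
  let ⟨C, hC⟩ := f.exists_bound
  AddMonoidHomClass.continuous_of_bound f C hC

theorem sub_apply (f g : BanHom M N) (x : M) : (f - g) x = f x - g x := by
  rw [sub_eq_add_neg, add_apply, neg_apply, sub_eq_add_neg]

theorem comp_zero (g : BanHom N T) : g.comp (0 : BanHom M N) = 0 := ext fun _ => map_zero g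

theorem comp_sub (g : BanHom N T) (f f' : BanHom M N) : g.comp (f - f') = g.comp f - g.comp f' :=
  ext fun x => by simp only [comp_apply, sub_apply, map_sub]

end BanHom

namespace StrictExactAt

variable {f : BanHom M N} {g : BanHom N T}

theorem range_eq (h : StrictExactAt f g) : Set.range f = {y | g y = 0} := by
  rw [← h.1, h.2.1.closure_eq]

theorem comp_eq_zero (h : StrictExactAt f g) : g.comp f = 0 :=
  BanHom.ext fun x => h.range_eq.subset ⟨x, rfl⟩

theorem of_section_on_ker (hgf : g.comp f = 0) (h : BanHom N M)
    (hh : ∀ y, g y = 0 → f (h y) = y) : StrictExactAt f g := by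
  have hrange : Set.range f = {y | g y = 0} :=
    Set.Subset.antisymm (Set.range_subset_iff.2 (DFunLike.congr_fun hgf)) fun y hy => ⟨h y, hh y hy⟩
  have hclosed : IsClosed (Set.range f) := by
    rw [hrange]
    exact isClosed_eq g.continuous continuous_const
  obtain ⟨C, hC⟩ := h.exists_bound
  exact ⟨hclosed.closure_eq.trans hrange, hclosed, C,
    fun x => ⟨h (f x), hh _ (DFunLike.congr_fun hgf x), hC _⟩⟩

/-- The error `1 - f ∘ h` is removed by a finite Neumann series. -/
theorem of_iterate_eq_zero (hgf : g.comp f = 0) (h : BanHom N M) (k : ℕ)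
    (hk : ∀ y, g y = 0 → (fun y => y - f (h y))^[k] y = 0) : StrictExactAt f g := by
  have neumann : ∀ k, ∃ G : BanHom N M, ∀ y, y - f (G y) = (fun y => y - f (h y))^[k] y := by
    intro k
    induction k with
    | zero => exact ⟨0, fun y => by rw [BanHom.zero_apply, map_zero, sub_zero]; rfl⟩
    | succ k ih =>
      obtain ⟨G, hG⟩ := ih
      refine ⟨G + h.comp (BanHom.id N - f.comp G), fun y => ?_⟩
      rw [Function.iterate_succ_apply', ← hG, BanHom.add_apply, map_add, ← sub_sub,
        BanHom.comp_apply, BanHom.sub_apply, BanHom.id_apply, BanHom.comp_apply]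
  obtain ⟨G, hG⟩ := neumann k
  exact of_section_on_ker hgf G fun y hy => (sub_eq_zero.1 ((hG y).trans (hk y hy))).symm

end StrictExactAt

/-- The kernel of a morphism, with the norm of the source. It is the target of the strict
epimorphism along which projective modules are lifted in a strictly exact sequence. -/
def BanMod.ker (g : BanHom N T) : BanMod 𝒞 A where
  carrier := LinearMap.ker g.toLinearMap
  complete :=
    have : IsClosed ((LinearMap.ker g.toLinearMap : Submodule A N) : Set N) :=
      isClosed_eq g.continuous continuous_const
    this.completeSpace_coe
  kind := ⟨fun h =>
    have := N.kind.ultra h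
    ⟨fun x y z => IsUltrametricDist.dist_triangle_max (x : N) y z⟩⟩
  exists_smul_bound :=
    let ⟨C, hC⟩ := N.exists_smul_bound
    ⟨C, fun a x => hC a (x : N)⟩

/-- The factorization of a morphism through a kernel. -/
def BanHom.codRestrictKer (g : BanHom N T) (f : BanHom M N) (h : g.comp f = 0) :
    BanHom M (BanMod.ker g) where
  toLinearMap := f.toLinearMap.codRestrict _ (DFunLike.congr_fun h)
  exists_bound :=
    let ⟨C, hC⟩ := f.exists_bound
    ⟨C, fun x => hC x⟩

theorem BanMod.IsProjective.exists_comp_eq {Q : BanMod 𝒞 A} (hQ : Q.IsProjective)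
    {f : BanHom M N} {g : BanHom N T} (hfg : StrictExactAt f g) (h : BanHom Q N)
    (hgh : g.comp h = 0) : ∃ k : BanHom Q M, f.comp k = h := by
  let p := g.codRestrictKer f hfg.comp_eq_zero
  have hsurj : Function.Surjective p := fun ⟨y, hy⟩ =>
    let ⟨x, hx⟩ := hfg.range_eq.superset hy
    ⟨x, Subtype.ext hx⟩
  have hstrict : p.IsStrict :=
    let ⟨C, hC⟩ := hfg.2.2
    ⟨hsurj.range_eq ▸ isClosed_univ, C, fun x =>
      let ⟨x', h1, h2⟩ := hC x
      ⟨x', Subtype.ext h1, h2⟩⟩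
  obtain ⟨k, hk⟩ := hQ _ _ p hsurj.denseRange hstrict (g.codRestrictKer h hgh)
  exact ⟨k, BanHom.ext fun x => congrArg Subtype.val (DFunLike.congr_fun hk x)⟩

theorem StrictExactAt.exists_comp_add_comp_eq_id {f : BanHom M N} {g : BanHom N T}
    (hfg : StrictExactAt f g) (hN : N.IsProjective) (s : BanHom T N)
    (hs : g.comp (s.comp g) = g) :
    ∃ t : BanHom N M, s.comp g + f.comp t = BanHom.id N ∧ f.comp (t.comp f) = f := by
  obtain ⟨t, ht⟩ := hN.exists_comp_eq hfg (BanHom.id N - s.comp g) (by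
    rw [BanHom.comp_sub, hs, BanHom.comp_id, sub_self])
  refine ⟨t, by rw [ht, add_sub_cancel], ?_⟩
  ext x
  have hx : f (t (f x)) = f x - s (g (f x)) := by
    rw [← BanHom.comp_apply f t, ht, BanHom.sub_apply, BanHom.comp_apply, BanHom.id_apply]
  have hgfx : g (f x) = 0 := DFunLike.congr_fun hfg.comp_eq_zero x
  rw [BanHom.comp_apply, BanHom.comp_apply, hx, hgfx, map_zero, sub_zero]

end StrictExactness

/-! ### Contractions of augmented complexes -/

namespace BanComplex

variable {𝒞 : BanachKind} {A : Type u} [BanachRing A]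

/-- A contracting homotopy of the augmented complex `⋯ → K_1 → K_0 → M → 0`: the maps `s` in
positive degrees, and `σ` from the augmentation target. -/
structure Contraction (K : BanComplex 𝒞 A) {M : BanMod 𝒞 A} (ε : BanHom (K.X 0) M) where
  aug_d : ε.comp (K.d 0) = 0
  σ : BanHom M (K.X 0)
  s : ∀ n, BanHom (K.X n) (K.X (n + 1))
  aug_σ : ε.comp σ = BanHom.id M
  zero_eq : σ.comp ε + (K.d 0).comp (s 0) = BanHom.id (K.X 0)
  succ_eq : ∀ n, (s n).comp (K.d n) + (K.d (n + 1)).comp (s (n + 1)) = BanHom.id (K.X (n + 1))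

namespace Contraction

variable {K : BanComplex 𝒞 A} {M N : BanMod 𝒞 A} {ε : BanHom (K.X 0) M}

theorem zero_apply (c : K.Contraction ε) (x : K.X 0) : c.σ (ε x) + K.d 0 (c.s 0 x) = x :=
  DFunLike.congr_fun c.zero_eq x

theorem succ_apply (c : K.Contraction ε) (n : ℕ) (x : K.X (n + 1)) :
    c.s n (K.d n x) + K.d (n + 1) (c.s (n + 1) x) = x :=
  DFunLike.congr_fun (c.succ_eq n) x

theorem aug_σ_apply (c : K.Contraction ε) (x : M) : ε (c.σ x) = x :=
  DFunLike.congr_fun c.aug_σ x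

theorem isQuasiIsoTo (c : K.Contraction ε) : K.IsQuasiIsoTo ε := by
  refine ⟨.of_section_on_ker rfl c.σ fun y _ => c.aug_σ_apply y,
    .of_section_on_ker c.aug_d (c.s 0) fun y hy => ?_,
    fun n => .of_section_on_ker (K.d_comp_d n) (c.s (n + 1)) fun y hy => ?_⟩
  · simpa only [hy, map_zero, zero_add] using c.zero_apply y
  · simpa only [hy, map_zero, zero_add] using c.succ_apply n y

/-- The transport of a contraction along an isomorphism of augmentation targets. -/
def trans (c : K.Contraction ε) (f : BanHom M N) (g : BanHom N M)
    (hfg : f.comp g = BanHom.id N) (hgf : g.comp f = BanHom.id M) :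
    K.Contraction (f.comp ε) where
  aug_d := by rw [BanHom.comp_assoc, c.aug_d, BanHom.comp_zero]
  σ := c.σ.comp g
  s := c.s
  aug_σ := by rw [BanHom.comp_assoc, ← BanHom.comp_assoc ε, c.aug_σ, BanHom.id_comp, hfg]
  zero_eq := by rw [BanHom.comp_assoc, ← BanHom.comp_assoc g, hgf, BanHom.id_comp, c.zero_eq]
  succ_eq := c.succ_eq

end Contraction

end BanComplex

theorem BanResolution.nonempty_contraction {𝒞 : BanachKind} {A : Type u} [BanachRing A]
    {M : BanMod 𝒞 A} (P : BanResolution M) (hM : M.IsProjective) :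
    Nonempty (P.P.Contraction P.aug) := by
  obtain ⟨hε, h₀, hd⟩ := P.quasiIso
  obtain ⟨σ, hσ⟩ := hM.exists_comp_eq hε (BanHom.id M) rfl
  obtain ⟨s₀, hs₀, hs₀'⟩ := h₀.exists_comp_add_comp_eq_id (P.projective 0) σ (by
    rw [← BanHom.comp_assoc, hσ, BanHom.id_comp])
  have step (n : ℕ)
      (s : {s : BanHom (P.P.X n) (P.P.X (n + 1)) // (P.P.d n).comp (s.comp (P.P.d n)) = P.P.d n}) :=
    (hd n).exists_comp_add_comp_eq_id (P.projective (n + 1)) s.1 s.2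
  choose next hnext hnext' using step
  let s : ∀ n, {s : BanHom (P.P.X n) (P.P.X (n + 1)) //
      (P.P.d n).comp (s.comp (P.P.d n)) = P.P.d n} :=
    Nat.rec ⟨s₀, hs₀'⟩ fun n s => ⟨next n s, hnext' n s⟩
  exact ⟨{
    aug_d := h₀.comp_eq_zero
    σ := σ
    s := fun n => (s n).1
    aug_σ := hσ
    zero_eq := hs₀
    succ_eq := fun n => hnext n (s n) }⟩

/-! ### Tensor products of contractions -/

namespace BanHom

variable {𝒞 : BanachKind} {A : Type u} [BanachRing A] {M N M' N' : BanMod 𝒞 A}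

theorem add_tensorMap (f f' : BanHom M M') (g : BanHom N N') :
    (f + f').tensorMap g = f.tensorMap g + f'.tensorMap g :=
  BanMod.tensor_hom_ext fun m n => by
    simp only [tensorMap_tmul, add_apply, map_add, LinearMap.add_apply]

theorem tensorMap_add (f : BanHom M M') (g g' : BanHom N N') :
    f.tensorMap (g + g') = f.tensorMap g + f.tensorMap g' :=
  BanMod.tensor_hom_ext fun m n => by simp only [tensorMap_tmul, add_apply, map_add]

theorem id_tensorMap_id : (BanHom.id M).tensorMap (BanHom.id N) = BanHom.id (M.tensor N) :=
  BanMod.tensor_hom_ext fun m n => by simp only [tensorMap_tmul, id_apply]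

theorem tensorMap_add_add_eq_id {f g : BanHom M M} {f' g' : BanHom N N}
    (h : f + g = BanHom.id M) (h' : f' + g' = BanHom.id N) :
    f.tensorMap f' + (g.tensorMap (BanHom.id N) + f.tensorMap g') = BanHom.id (M.tensor N) := by
  rw [add_left_comm, ← tensorMap_add, h', ← add_tensorMap, add_comm, h, id_tensorMap_id]

end BanHom

namespace BanComplex

variable {𝒞 : BanachKind} {A : Type u} [BanachRing A]

section Tot

variable (P Q : BanComplex 𝒞 A)

/-- The projection of the total complex to its component of bidegree `(i, j)`. -/
noncomputable def totProj {i j n : ℕ} (h : i + j = n) :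
    BanHom ((P.tot Q).X n) ((P.X i).tensor (Q.X j)) :=
  BanMod.proj (fun p : TotIdx n => (P.X p.1.1).tensor (Q.X p.1.2)) ⟨(i, j), h⟩

variable {P Q}

theorem tot_hom_ext {W : BanMod 𝒞 A} {n : ℕ} {f g : BanHom W ((P.tot Q).X n)}
    (hfg : ∀ i j (h : i + j = n), (totProj P Q h).comp f = (totProj P Q h).comp g) : f = g :=
  BanMod.pi_hom_ext fun p => hfg p.1.1 p.1.2 p.2

theorem totProj_comp_d {i j n : ℕ} (h : i + j = n) :
    (totProj P Q h).comp ((P.tot Q).d n) =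
      ((P.d i).tensorMap (BanHom.id (Q.X j))).comp (totProj P Q (by omega)) +
      (-1 : ℤ) ^ i • ((BanHom.id (P.X i)).tensorMap (Q.d j)).comp (totProj P Q (by omega)) :=
  proj_comp_totD P Q n ⟨(i, j), h⟩

variable {M N : BanMod 𝒞 A} {ε : BanHom (P.X 0) M} {η : BanHom (Q.X 0) N}

/-- The augmentation `ε ⊗̂ η` of the total complex. -/
noncomputable def totAug (ε : BanHom (P.X 0) M) (η : BanHom (Q.X 0) N) :
    BanHom ((P.tot Q).X 0) (M.tensor N) :=
  (ε.tensorMap η).comp (totProj P Q rfl)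

theorem totAug_comp_d (hε : ε.comp (P.d 0) = 0) (hη : η.comp (Q.d 0) = 0) :
    (totAug ε η).comp ((P.tot Q).d 0) = 0 := by
  rw [totAug, BanHom.comp_assoc, totProj_comp_d, BanHom.comp_add, BanHom.comp_zsmul,
    ← BanHom.comp_assoc, ← BanHom.comp_assoc, BanHom.tensorMap_comp, BanHom.tensorMap_comp, hε, hη,
    BanHom.zero_tensorMap, BanHom.tensorMap_zero, BanHom.zero_comp, BanHom.zero_comp, smul_zero,
    add_zero]

namespace Contraction

variable (c : P.Contraction ε) (c' : Q.Contraction η)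

/-- The section `σ ⊗̂ σ'` of the augmentation of the total complex. -/
noncomputable def totσ : BanHom (M.tensor N) ((P.tot Q).X 0) :=
  BanMod.piLift fun p : TotIdx 0 =>
    match p with
    | ⟨(0, 0), _⟩ => c.σ.tensorMap c'.σ
    | ⟨(0, _ + 1), _⟩ => 0
    | ⟨(_ + 1, _), _⟩ => 0

theorem totProj_comp_totσ :
    (totProj P Q rfl).comp (totσ c c') = c.σ.tensorMap c'.σ := rfl

/-- The homotopy `s ⊗̂ 1 + σε ⊗̂ s'` on the total complex. -/
noncomputable def totS (n : ℕ) : BanHom ((P.tot Q).X n) ((P.tot Q).X (n + 1)) :=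
  BanMod.piLift fun p : TotIdx (n + 1) =>
    match p with
    | ⟨(0, 0), _⟩ => 0
    | ⟨(0, j + 1), h⟩ =>
      ((c.σ.comp ε).tensorMap (c'.s j)).comp (totProj P Q (by simp only at h; omega))
    | ⟨(i + 1, j), h⟩ =>
      ((c.s i).tensorMap (BanHom.id (Q.X j))).comp (totProj P Q (by simp only at h; omega))

theorem totProj_comp_totS_zero {j n : ℕ} (h : 0 + (j + 1) = n + 1) :
    (totProj P Q h).comp (totS c c' n) =
      ((c.σ.comp ε).tensorMap (c'.s j)).comp (totProj P Q (by omega)) := rfl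

theorem totProj_comp_totS_succ {i j n : ℕ} (h : i + 1 + j = n + 1) :
    (totProj P Q h).comp (totS c c' n) =
      ((c.s i).tensorMap (BanHom.id (Q.X j))).comp (totProj P Q (by omega)) := rfl

theorem totσ_comp_totAug_add_d_comp_totS :
    (totσ c c').comp (totAug ε η) + ((P.tot Q).d 0).comp (totS c c' 0) = BanHom.id _ := by
  refine tot_hom_ext fun i j h => ?_
  obtain ⟨rfl, rfl⟩ : i = 0 ∧ j = 0 := by omega
  rw [BanHom.comp_add, ← BanHom.comp_assoc, ← BanHom.comp_assoc, totProj_comp_totσ,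
    totProj_comp_d, BanHom.add_comp, BanHom.zsmul_comp, pow_zero, one_smul, BanHom.comp_assoc,
    BanHom.comp_assoc, totProj_comp_totS_zero, totProj_comp_totS_succ, totAug]
  simp only [← BanHom.comp_assoc, BanHom.tensorMap_comp, BanHom.id_comp, ← BanHom.add_comp]
  rw [BanHom.tensorMap_add_add_eq_id c.zero_eq c'.zero_eq, BanHom.id_comp, BanHom.comp_id]

theorem totProj_zero_comp_totS_d_add_d_totS {j n : ℕ} (h : 0 + (j + 1) = n + 1) :
    (totProj P Q h).comp
        ((totS c c' n).comp ((P.tot Q).d n) + ((P.tot Q).d (n + 1)).comp (totS c c' (n + 1))) =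
      totProj P Q h := by
  rw [BanHom.comp_add, ← BanHom.comp_assoc, ← BanHom.comp_assoc, totProj_comp_totS_zero,
    BanHom.comp_assoc, totProj_comp_d, totProj_comp_d, BanHom.comp_add, BanHom.add_comp, pow_zero,
    one_smul, one_smul, BanHom.comp_assoc, BanHom.comp_assoc, totProj_comp_totS_zero,
    totProj_comp_totS_succ]
  simp only [← BanHom.comp_assoc, BanHom.tensorMap_comp]
  rw [BanHom.comp_assoc c.σ, c.aug_d, BanHom.comp_zero, BanHom.zero_tensorMap, BanHom.zero_comp,
    zero_add]
  simp only [BanHom.id_comp, BanHom.comp_id, ← BanHom.add_comp]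
  rw [BanHom.tensorMap_add_add_eq_id c.zero_eq (c'.succ_eq j), BanHom.id_comp]

theorem totProj_succ_comp_totS_d_add_d_totS {i j n : ℕ} (h : i + 1 + j = n + 1) :
    (totProj P Q h).comp
        ((totS c c' n).comp ((P.tot Q).d n) + ((P.tot Q).d (n + 1)).comp (totS c c' (n + 1))) =
      totProj P Q h := by
  rw [BanHom.comp_add, ← BanHom.comp_assoc, ← BanHom.comp_assoc, totProj_comp_totS_succ,
    BanHom.comp_assoc, totProj_comp_d, totProj_comp_d, BanHom.comp_add, BanHom.add_comp,
    BanHom.comp_zsmul, BanHom.zsmul_comp, BanHom.comp_assoc, BanHom.comp_assoc,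
    totProj_comp_totS_succ, totProj_comp_totS_succ]
  simp only [← BanHom.comp_assoc, BanHom.tensorMap_comp, BanHom.id_comp, BanHom.comp_id]
  rw [pow_succ, mul_neg_one, neg_smul, add_add_add_comm, add_neg_cancel, add_zero,
    ← BanHom.add_comp, ← BanHom.add_tensorMap, c.succ_eq, BanHom.id_tensorMap_id, BanHom.id_comp]

/-- The tensor product of two contractions. -/
noncomputable def tot : (P.tot Q).Contraction (totAug ε η) where
  aug_d := totAug_comp_d c.aug_d c'.aug_d
  σ := totσ c c'
  s := totS c c'
  aug_σ := by
    rw [totAug, BanHom.comp_assoc, totProj_comp_totσ, BanHom.tensorMap_comp, c.aug_σ, c'.aug_σ,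
      BanHom.id_tensorMap_id]
  zero_eq := totσ_comp_totAug_add_d_comp_totS c c'
  succ_eq n := tot_hom_ext fun i j h => by
    rcases i with _ | i
    · obtain ⟨j, rfl⟩ : ∃ k, j = k + 1 := ⟨n, by omega⟩
      exact totProj_zero_comp_totS_d_add_d_totS c c' h
    · exact totProj_succ_comp_totS_d_add_d_totS c c' h

end Contraction

end Tot

/-- The complex with `M` in degree `0` and zero elsewhere. -/
def single (M : BanMod 𝒞 A) : BanComplex 𝒞 A where
  X
    | 0 => M
    | _ + 1 => BanMod.zero 𝒞 A
  d _ := 0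
  d_comp_d _ := rfl

/-- The trivial contraction of `single M`, augmented by the identity of `M`. -/
def singleContraction (M : BanMod 𝒞 A) : (single M).Contraction (BanHom.id M) where
  aug_d := rfl
  σ := BanHom.id M
  s _ := 0
  aug_σ := rfl
  zero_eq := BanHom.ext fun x => add_zero x
  succ_eq _ := rfl

end BanComplex

section TensorList

variable {𝒞 : BanachKind} {A : Type u} [BanachRing A] [IsOfKind 𝒞 A] {ι : Type}
  {P : ι → BanComplex 𝒞 A} {M : ι → BanMod 𝒞 A} {ε : ∀ i, BanHom ((P i).X 0) (M i)}

/-- The augmentation of a tensor product of augmented complexes. -/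
noncomputable def tensorListAug (ε : ∀ i, BanHom ((P i).X 0) (M i)) :
    ∀ l : List ι, BanHom ((tensorListC P l).X 0) (tensorList M l)
  | [] => BanHom.id _
  | i :: l => BanComplex.totAug (P := P i) (Q := tensorListC P l) (ε i) (tensorListAug ε l)

theorem tensorListAug_comp_d (hε : ∀ i, (ε i).comp ((P i).d 0) = 0) :
    ∀ l : List ι, (tensorListAug ε l).comp ((tensorListC P l).d 0) = 0
  | [] => rfl
  | i :: l => BanComplex.totAug_comp_d (hε i) (tensorListAug_comp_d hε l)

/-- The contraction of a tensor product of contracted complexes. -/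
noncomputable def tensorListContraction (c : ∀ i, (P i).Contraction (ε i)) :
    ∀ l : List ι, (tensorListC P l).Contraction (tensorListAug ε l)
  | [] => BanComplex.singleContraction (BanMod.regular 𝒞 A)
  | i :: l => (c i).tot (tensorListContraction c l)

end TensorList

/-! ### Quotients by idempotents -/

theorem BanachRing.continuous_mul_const {A : Type u} [BanachRing A] (b : A) :
    Continuous fun a : A => a * b := by
  obtain ⟨C, hC⟩ := BanachRing.exists_mul_bound (R := A)
  exact AddMonoidHomClass.continuous_of_bound (AddMonoidHom.mulRight b) (C * ‖b‖)
    fun a => (hC a b).trans_eq (mul_right_comm _ _ _)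

theorem span_singleton_eq_setOf_mul_one_sub_eq_zero {A : Type u} [CommRing A] {e : A}
    (he : IsIdempotentElem e) : (Ideal.span {e} : Set A) = {a | a * (1 - e) = 0} := by
  ext a
  rw [SetLike.mem_coe, Ideal.mem_span_singleton']
  constructor
  · rintro ⟨b, rfl⟩
    exact (mul_assoc _ _ _).trans (by rw [he.mul_one_sub_self, mul_zero])
  · exact fun ha : a * (1 - e) = 0 => ⟨a, by linear_combination -ha⟩

theorem span_singleton_injOn_isIdempotentElem (A : Type u) [CommRing A] :
    Set.InjOn (fun e : A => Ideal.span {e}) {e | IsIdempotentElem e} := by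
  have mul_eq {e f : A} (hf : IsIdempotentElem f)
      (h : (Ideal.span {e} : Ideal A) = Ideal.span {f}) : e * f = e := by
    obtain ⟨a, rfl⟩ := Ideal.mem_span_singleton'.1 (h ▸ Ideal.mem_span_singleton_self e)
    rw [mul_assoc, hf.eq]
  intro e he f hf h
  rw [← mul_eq hf h, mul_comm, mul_eq he h.symm]

theorem isClosed_span_singleton_of_isIdempotentElem {A : Type u} [BanachRing A] {e : A}
    (he : IsIdempotentElem e) : IsClosed (Ideal.span {e} : Set A) := by
  rw [span_singleton_eq_setOf_mul_one_sub_eq_zero he]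
  exact isClosed_eq (BanachRing.continuous_mul_const _) continuous_const

section Projective

variable {𝒞 : BanachKind} {A : Type u} [BanachRing A]

namespace BanMod

theorem isProjective_zero : (BanMod.zero 𝒞 A).IsProjective := fun _ _ _ _ _ f =>
  ⟨0, BanHom.ext fun x => by
    rw [BanHom.comp_zero, BanHom.zero_apply, Subsingleton.elim (α := PUnit) x 0]
    exact (map_zero f).symm⟩

/-- The morphism `A → N`, `a ↦ a • n`. -/
def smulHom [IsOfKind 𝒞 A] (N : BanMod 𝒞 A) (n : N) : BanHom (BanMod.regular 𝒞 A) N where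
  toLinearMap := LinearMap.toSpanSingleton A N n
  exists_bound :=
    let ⟨C, hC⟩ := N.exists_smul_bound
    ⟨C * ‖n‖, fun a => (hC a n).trans_eq (mul_right_comm _ _ _)⟩

theorem isProjective_regular [IsOfKind 𝒞 A] : (BanMod.regular 𝒞 A).IsProjective := by
  intro N T p hdense hstrict f
  have hsurj : Function.Surjective p := by
    rw [← Set.range_eq_univ, ← hstrict.1.closure_eq]
    exact hdense.closure_range
  obtain ⟨n, hn⟩ := hsurj (f (1 : A))
  refine ⟨N.smulHom n, BanHom.ext fun (a : A) => ?_⟩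
  calc p (a • n) = a • f (1 : A) := by rw [map_smul, hn]
    _ = f (a • (1 : A)) := (map_smul f a (1 : A)).symm
    _ = f a := congrArg f (mul_one (M := A) a)

theorem IsProjective.of_retract {M N : BanMod 𝒞 A} (hN : N.IsProjective) (i : BanHom M N)
    (r : BanHom N M) (hri : r.comp i = BanHom.id M) : M.IsProjective :=
  fun X Y p hdense hstrict f =>
  let ⟨g, hg⟩ := hN X Y p hdense hstrict (f.comp r)
  ⟨g.comp i, by rw [← BanHom.comp_assoc, hg, BanHom.comp_assoc, hri, BanHom.comp_id]⟩

end BanMod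

/-- The resolution of a projective module by itself. -/
def BanResolution.single {M : BanMod 𝒞 A} (hM : M.IsProjective) : BanResolution M where
  P := BanComplex.single M
  projective
    | 0 => hM
    | _ + 1 => BanMod.isProjective_zero
  aug := BanHom.id M
  quasiIso := (BanComplex.singleContraction M).isQuasiIsoTo

end Projective

namespace BanAlg

variable {𝒞 : BanachKind} {A : Type u} [BanachRing A]

theorem isEpi_of_surjective {B : BanAlg 𝒞 A} (hB : Function.Surjective (algebraMap A B)) :
    B.IsEpi := fun D f g _ _ _ => AlgHom.ext fun b => by
  obtain ⟨a, rfl⟩ := hB b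
  rw [f.commutes, g.commutes]

/-- The unit of `B` as an element of its underlying module. -/
def unitElt (B : BanAlg 𝒞 A) : B.toMod := (1 : B)

theorem exists_smul_unitElt {B : BanAlg 𝒞 A} (hB : Function.Surjective (algebraMap A B))
    (b : B.toMod) : ∃ a : A, a • B.unitElt = b :=
  let ⟨a, ha⟩ := hB b
  ⟨a, (Algebra.algebraMap_eq_smul_one (A := B) a).symm.trans ha⟩

theorem mul_comp_tmulLeft_unitElt (B : BanAlg 𝒞 A) :
    B.mul.comp (BanMod.tmulLeft B.unitElt B.toMod) = BanHom.id B.toMod :=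
  BanHom.ext fun b => (BanMod.tensorLift_tmul _ _ _ _).trans (one_mul (M := B) b)

theorem tmulLeft_unitElt_comp_mul {B : BanAlg 𝒞 A} (hB : Function.Surjective (algebraMap A B)) :
    (BanMod.tmulLeft B.unitElt B.toMod).comp B.mul = BanHom.id _ :=
  BanMod.tensor_hom_ext fun b c => by
    obtain ⟨a, rfl⟩ := exists_smul_unitElt hB b
    have h : B.mul (B.toMod.tmul B.toMod B.unitElt c) = c :=
      DFunLike.congr_fun B.mul_comp_tmulLeft_unitElt c
    rw [map_smul, LinearMap.smul_apply, map_smul, map_smul, BanHom.comp_apply, h]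
    rfl

theorem isHomotopyEpi_of_surjective {B : BanAlg 𝒞 A} (hproj : B.toMod.IsProjective)
    (hB : Function.Surjective (algebraMap A B)) : B.IsHomotopyEpi := by
  refine ⟨⟨BanResolution.single hproj⟩, fun P Q => ?_⟩
  obtain ⟨c⟩ := P.nonempty_contraction hproj
  obtain ⟨c'⟩ := Q.nonempty_contraction hproj
  exact ((c.tot c').trans B.mul _ B.mul_comp_tmulLeft_unitElt
    (tmulLeft_unitElt_comp_mul hB)).isQuasiIsoTo

theorem nonempty_unitalResolution {B : BanAlg 𝒞 A} (hproj : B.toMod.IsProjective) :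
    Nonempty B.UnitalResolution :=
  ⟨{ BanResolution.single hproj with
      one := (1 : B)
      aug_one := rfl }⟩

section Quotient

variable [IsOfKind 𝒞 A]

theorem algebraMap_quotient_surjective {I : Ideal A} (hI : IsClosed (I : Set A)) :
    Function.Surjective (algebraMap A (BanAlg.quotient 𝒞 I hI)) :=
  Ideal.Quotient.mk_surjective

theorem quotient_injective {I J : Ideal A} {hI : IsClosed (I : Set A)} {hJ : IsClosed (J : Set A)}
    (h : BanAlg.quotient 𝒞 I hI = BanAlg.quotient 𝒞 J hJ) : I = J := by
  have ker_eq (I : Ideal A) (hI : IsClosed (I : Set A)) :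
      RingHom.ker (algebraMap A (BanAlg.quotient 𝒞 I hI)) = I := Ideal.mk_ker
  rw [← ker_eq I hI, ← ker_eq J hJ, h]

/-- The factorization of a morphism which vanishes on a closed ideal through the quotient. -/
noncomputable def quotientLift {I : Ideal A} (hI : IsClosed (I : Set A)) {N : BanMod 𝒞 A}
    (f : BanHom (BanMod.regular 𝒞 A) N) (hf : ∀ a ∈ I, f a = 0) :
    BanHom (BanAlg.quotient 𝒞 I hI).toMod N where
  toFun := Submodule.liftQ I f.toLinearMap hf
  map_add' x y := map_add (Submodule.liftQ I f.toLinearMap hf) x y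
  map_smul' a x := by
    obtain ⟨b, rfl⟩ := algebraMap_quotient_surjective (𝒞 := 𝒞) hI x
    exact map_smul f a b
  exists_bound :=
    let ⟨C, hC⟩ := f.exists_bound
    let F : NormedAddGroupHom A N :=
      AddMonoidHom.mkNormedAddGroupHom f.toLinearMap.toAddMonoidHom C hC
    ⟨‖F‖, QuotientAddGroup.norm_lift_apply_le (S := I.toAddSubgroup) F fun a ha => hf a ha⟩

/-- The quotient of `A` by the closed ideal generated by an idempotent. -/
noncomputable def idempotentQuotient (𝒞 : BanachKind) [IsOfKind 𝒞 A] {e : A}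
    (he : IsIdempotentElem e) : BanAlg 𝒞 A :=
  BanAlg.quotient 𝒞 (Ideal.span {e}) (isClosed_span_singleton_of_isIdempotentElem he)

variable {e : A} (he : IsIdempotentElem e)

theorem algebraMap_idempotentQuotient_surjective :
    Function.Surjective (algebraMap A (idempotentQuotient 𝒞 he)) :=
  algebraMap_quotient_surjective _

theorem smul_unitElt_idempotentQuotient :
    e • (idempotentQuotient 𝒞 he).unitElt = 0 :=
  (Algebra.algebraMap_eq_smul_one (A := idempotentQuotient 𝒞 he) e).symm.trans
    (Ideal.Quotient.eq_zero_iff_mem.2 (Ideal.mem_span_singleton_self e))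

theorem idempotentQuotient_inj {f : A} (hf : IsIdempotentElem f)
    (h : idempotentQuotient 𝒞 he = idempotentQuotient 𝒞 hf) : e = f :=
  span_singleton_injOn_isIdempotentElem A he hf (quotient_injective h)

/-- The embedding `A / eA → A` as a direct summand, induced by multiplication by `1 - e`. -/
noncomputable def idempotentSection :
    BanHom (idempotentQuotient 𝒞 he).toMod (BanMod.regular 𝒞 A) :=
  quotientLift _ ((BanMod.regular 𝒞 A).smulHom (1 - e : A)) fun _ ha =>
    (span_singleton_eq_setOf_mul_one_sub_eq_zero he).subset ha

theorem idempotentSection_unitElt :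
    idempotentSection he (idempotentQuotient 𝒞 he).unitElt = (1 - e : A) :=
  one_mul (1 - e : A)

theorem isProjective_idempotentQuotient : (idempotentQuotient 𝒞 he).toMod.IsProjective := by
  refine BanMod.isProjective_regular.of_retract (idempotentSection he)
    ((idempotentQuotient 𝒞 he).toMod.smulHom (unitElt _)) (BanHom.ext fun b => ?_)
  obtain ⟨a, rfl⟩ := algebraMap_idempotentQuotient_surjective (𝒞 := 𝒞) he b
  change Ideal.Quotient.mk (Ideal.span {e}) (a * (1 - e) * 1) = Ideal.Quotient.mk _ a
  rw [Ideal.Quotient.mk_eq_mk_iff_sub_mem, Ideal.mem_span_singleton']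
  exact ⟨-a, by ring⟩

theorem isHomotopyEpi_idempotentQuotient : (idempotentQuotient 𝒞 he).IsHomotopyEpi :=
  isHomotopyEpi_of_surjective (isProjective_idempotentQuotient he)
    (algebraMap_idempotentQuotient_surjective (𝒞 := 𝒞) he)

end Quotient

end BanAlg

/-! ### Coface maps -/

section TmulLeft

variable {𝒞 : BanachKind} {A : Type u} [BanachRing A] {M M' N N' : BanMod 𝒞 A}

theorem BanHom.tensorMap_comp_tmulLeft (f : BanHom M M') (g : BanHom N N') (m : M) :
    (f.tensorMap g).comp (BanMod.tmulLeft m N) = (BanMod.tmulLeft (f m) N').comp g :=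
  BanHom.ext fun n => BanHom.tensorMap_tmul f g m n

end TmulLeft

namespace BanComplex

variable {𝒞 : BanachKind} {A : Type u} [BanachRing A]

/-- The degreewise morphism `P ⊗̂ K → P ⊗̂ L` induced by a degreewise morphism `K → L`. -/
noncomputable def totMap (P : BanComplex 𝒞 A) {K L : BanComplex 𝒞 A}
    (f : ∀ q, BanHom (K.X q) (L.X q)) (q : ℕ) : BanHom ((P.tot K).X q) ((P.tot L).X q) :=
  BanMod.piLift fun p : TotIdx q =>
    ((BanHom.id (P.X p.1.1)).tensorMap (f p.1.2)).comp (totProj P K p.2)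

variable (P : BanComplex 𝒞 A) {K L : BanComplex 𝒞 A}

theorem totProj_comp_totMap (f : ∀ q, BanHom (K.X q) (L.X q)) {i j q : ℕ} (h : i + j = q) :
    (totProj P L h).comp (P.totMap f q) =
      ((BanHom.id (P.X i)).tensorMap (f j)).comp (totProj P K h) := rfl

theorem totMap_comp_totMap {L' : BanComplex 𝒞 A} (g : ∀ q, BanHom (L.X q) (L'.X q))
    (f : ∀ q, BanHom (K.X q) (L.X q)) (q : ℕ) :
    (P.totMap g q).comp (P.totMap f q) = P.totMap (fun q => (g q).comp (f q)) q :=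
  tot_hom_ext fun i j h => by
    rw [← BanHom.comp_assoc, totProj_comp_totMap, BanHom.comp_assoc, totProj_comp_totMap,
      ← BanHom.comp_assoc, BanHom.tensorMap_comp, BanHom.id_comp, totProj_comp_totMap]

theorem totMap_comp_d (f : ∀ q, BanHom (K.X q) (L.X q))
    (hf : ∀ q, (f q).comp (K.d q) = (L.d q).comp (f (q + 1))) (q : ℕ) :
    (P.totMap f q).comp ((P.tot K).d q) = ((P.tot L).d q).comp (P.totMap f (q + 1)) :=
  tot_hom_ext fun i j h => by
    rw [← BanHom.comp_assoc, ← BanHom.comp_assoc, totProj_comp_totMap, totProj_comp_d,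
      BanHom.comp_assoc, totProj_comp_d, BanHom.add_comp, BanHom.comp_add, BanHom.zsmul_comp,
      BanHom.comp_zsmul, BanHom.comp_assoc _ (totProj P L _), BanHom.comp_assoc _ (totProj P L _),
      totProj_comp_totMap, totProj_comp_totMap]
    simp only [← BanHom.comp_assoc, BanHom.tensorMap_comp, BanHom.id_comp, BanHom.comp_id, hf]

/-- The degreewise morphism `L → P ⊗̂ L`, `x ↦ e ⊗ x`, for an element `e` of degree `0`. -/
noncomputable def totTmulLeft (P : BanComplex 𝒞 A) (e : P.X 0) (L : BanComplex 𝒞 A) (q : ℕ) :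
    BanHom (L.X q) ((P.tot L).X q) :=
  BanMod.piLift fun p : TotIdx q =>
    match p with
    | ⟨(0, b), h⟩ =>
      (BanMod.tmulLeft e (L.X b)).comp (L.castX (by rw [← h]; exact Nat.zero_add b))
    | ⟨(_ + 1, _), _⟩ => 0

theorem totProj_comp_totTmulLeft (e : P.X 0) {q : ℕ} (h : 0 + q = q) :
    (totProj P L h).comp (P.totTmulLeft e L q) = BanMod.tmulLeft e (L.X q) := rfl

theorem totProj_succ_comp_totTmulLeft (e : P.X 0) {a b q : ℕ} (h : a + 1 + b = q) :
    (totProj P L h).comp (P.totTmulLeft e L q) = 0 := rfl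

theorem totMap_comp_totTmulLeft (e : P.X 0) (f : ∀ q, BanHom (K.X q) (L.X q)) (q : ℕ) :
    (P.totMap f q).comp (P.totTmulLeft e K q) = (P.totTmulLeft e L q).comp (f q) :=
  tot_hom_ext fun a b h => by
    rw [← BanHom.comp_assoc, ← BanHom.comp_assoc, totProj_comp_totMap, BanHom.comp_assoc]
    rcases a with _ | a
    · obtain rfl : q = b := by omega
      rw [totProj_comp_totTmulLeft, totProj_comp_totTmulLeft, BanHom.tensorMap_comp_tmulLeft,
        BanHom.id_apply]
    · rw [totProj_succ_comp_totTmulLeft, totProj_succ_comp_totTmulLeft, BanHom.comp_zero,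
        BanHom.zero_comp]

theorem totTmulLeft_comp_d (e : P.X 0) (q : ℕ) :
    (P.totTmulLeft e L q).comp (L.d q) = ((P.tot L).d q).comp (P.totTmulLeft e L (q + 1)) :=
  tot_hom_ext fun a b h => by
    rw [← BanHom.comp_assoc _ _ (L.d q), ← BanHom.comp_assoc _ ((P.tot L).d q), totProj_comp_d,
      BanHom.add_comp, BanHom.zsmul_comp, BanHom.comp_assoc _ _ (P.totTmulLeft e L (q + 1)),
      BanHom.comp_assoc _ _ (P.totTmulLeft e L (q + 1)), totProj_succ_comp_totTmulLeft,
      BanHom.comp_zero, zero_add]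
    rcases a with _ | a
    · obtain rfl : q = b := by omega
      rw [totProj_comp_totTmulLeft, totProj_comp_totTmulLeft, BanHom.tensorMap_comp_tmulLeft,
        BanHom.id_apply, pow_zero, one_smul]
    · rw [totProj_succ_comp_totTmulLeft, totProj_succ_comp_totTmulLeft, BanHom.comp_zero,
        BanHom.zero_comp, smul_zero]

end BanComplex

theorem sum_range_alternating_eq_zero {G : Type*} [AddCommGroup G] (n : ℕ) (a : ℕ → ℕ → G)
    (ha : ∀ j, a 0 j = a (j + 1) 0)
    (h : ∑ j ∈ Finset.range n, ∑ i ∈ Finset.range (n - 1),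
      ((-1 : ℤ) ^ j * (-1 : ℤ) ^ i) • a (j + 1) (i + 1) = 0) :
    ∑ j ∈ Finset.range (n + 1), ∑ i ∈ Finset.range n,
      ((-1 : ℤ) ^ j * (-1 : ℤ) ^ i) • a j i = 0 := by
  rcases n with _ | n
  · simp only [Finset.range_zero, Finset.sum_empty, Finset.sum_const_zero]
  have inner (j : ℕ) :
      ∑ i ∈ Finset.range (n + 1), ((-1 : ℤ) ^ (j + 1) * (-1 : ℤ) ^ i) • a (j + 1) i =
        ∑ i ∈ Finset.range n, ((-1 : ℤ) ^ j * (-1 : ℤ) ^ i) • a (j + 1) (i + 1) -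
          (-1 : ℤ) ^ j • a 0 j := by
    rw [Finset.sum_range_succ', ha, pow_zero, mul_one, sub_eq_add_neg, ← neg_smul]
    simp only [pow_succ, mul_neg_one, neg_mul_neg]
  rw [Finset.sum_range_succ']
  simp only [inner, Finset.sum_sub_distrib, pow_zero, one_mul]
  rw [Nat.add_sub_cancel] at h
  rw [h, zero_sub, neg_add_cancel]

/-- A functor from complexes and degreewise morphisms, which need not commute with the
differentials, to Banach modules. The cosimplicial identities relate coface maps between modules
indexed by lists which agree only propositionally; quantifying over such functors makes them
provable by induction on the list. -/
structure GradedBanFunctor (𝒞 : BanachKind) (A : Type u) [BanachRing A] where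
  obj : BanComplex 𝒞 A → BanMod 𝒞 A
  map : ∀ {K L : BanComplex 𝒞 A}, (∀ q, BanHom (K.X q) (L.X q)) → BanHom (obj K) (obj L)
  map_comp : ∀ {K L N : BanComplex 𝒞 A} (g : ∀ q, BanHom (L.X q) (N.X q))
    (f : ∀ q, BanHom (K.X q) (L.X q)), (map g).comp (map f) = map fun q => (g q).comp (f q)

namespace GradedBanFunctor

variable {𝒞 : BanachKind} {A : Type u} [BanachRing A]

/-- The functor `K ↦ K_q`. -/
def eval (𝒞 : BanachKind) (A : Type u) [BanachRing A] (q : ℕ) : GradedBanFunctor 𝒞 A where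
  obj K := K.X q
  map f := f q
  map_comp _ _ := rfl

/-- The functor `K ↦ F (P ⊗̂ K)`. -/
noncomputable def compTot (F : GradedBanFunctor 𝒞 A) (P : BanComplex 𝒞 A) :
    GradedBanFunctor 𝒞 A where
  obj K := F.obj (P.tot K)
  map f := F.map (P.totMap f)
  map_comp g f := (F.map_comp _ _).trans
    (congrArg F.map (funext fun q => P.totMap_comp_totMap g f q))

end GradedBanFunctor

section Cofaces

variable {𝒞 : BanachKind} {A : Type u} [BanachRing A] [IsOfKind 𝒞 A] {ι : Type}
  (P : ι → BanComplex 𝒞 A) (e : ∀ i, (P i).X 0)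

theorem cofaceC_comp_d (l : List ι) (j q : ℕ) :
    (cofaceC P e l j q).comp ((tensorListC P (l.eraseIdx j)).d q) =
      ((tensorListC P l).d q).comp (cofaceC P e l j (q + 1)) := by
  induction l generalizing j q with
  | nil => rfl
  | cons i l ih =>
    cases j with
    | zero => exact (P i).totTmulLeft_comp_d (e i) q
    | succ j => exact (P i).totMap_comp_d (cofaceC P e l j) (ih j) q

theorem GradedBanFunctor.sum_cofaceC_cofaceC (l : List ι) (F : GradedBanFunctor 𝒞 A)
    (x : ∀ l, F.obj (tensorListC P l)) :
    ∑ j ∈ Finset.range l.length, ∑ i ∈ Finset.range (l.length - 1),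
      ((-1 : ℤ) ^ j * (-1 : ℤ) ^ i) • F.map (cofaceC P e l j)
        (F.map (cofaceC P e (l.eraseIdx j) i) (x ((l.eraseIdx j).eraseIdx i))) = 0 := by
  induction l generalizing F with
  | nil => rfl
  | cons k l ih =>
    have hcomm (j : ℕ) : (F.map (cofaceC P e (k :: l) 0)).comp (F.map (cofaceC P e l j)) =
        (F.map (cofaceC P e (k :: l) (j + 1))).comp
          (F.map (cofaceC P e (k :: l.eraseIdx j) 0)) :=
      (F.map_comp _ _).trans ((congrArg F.map (funext fun q =>
        ((P k).totMap_comp_totTmulLeft (e k) (cofaceC P e l j) q).symm)).trans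
          (F.map_comp _ _).symm)
    exact sum_range_alternating_eq_zero (G := F.obj (tensorListC P (k :: l))) l.length
      (fun j i => F.map (cofaceC P e (k :: l) j)
        (F.map (cofaceC P e ((k :: l).eraseIdx j) i) (x (((k :: l).eraseIdx j).eraseIdx i))))
      (fun j => DFunLike.congr_fun (hcomm j) _) (ih (F.compTot (P k)) fun l => x (k :: l))

variable {P e} {M : ι → BanMod 𝒞 A} {v : ∀ i, M i} {ε : ∀ i, BanHom ((P i).X 0) (M i)}

theorem tensorListAug_comp_cofaceC (hv : ∀ i, ε i (e i) = v i) (l : List ι) (j : ℕ) :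
    (tensorListAug ε l).comp (cofaceC P e l j 0) =
      (coface M v l j).comp (tensorListAug ε (l.eraseIdx j)) := by
  induction l generalizing j with
  | nil => rfl
  | cons i l ih =>
    cases j with
    | zero =>
      refine (BanHom.tensorMap_comp_tmulLeft (ε i) (tensorListAug ε l) (e i)).trans ?_
      rw [hv]
      rfl
    | succ j =>
      have h : ((ε i).tensorMap (tensorListAug ε l)).comp
            ((BanHom.id ((P i).X 0)).tensorMap (cofaceC P e l j 0)) =
          ((BanHom.id (M i)).tensorMap (coface M v l j)).comp
            ((ε i).tensorMap (tensorListAug ε (l.eraseIdx j))) := by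
        rw [BanHom.tensorMap_comp, BanHom.tensorMap_comp, ih, BanHom.comp_id, BanHom.id_comp]
      exact congrArg (BanHom.comp · (BanComplex.totProj (P i) _ rfl)) h

end Cofaces

/-! ### Differentials on unrestricted cochains -/

section CechFun

variable {𝒞 : BanachKind} {A : Type u} [BanachRing A] [IsOfKind 𝒞 A] {ι : Type}

/-- The Tate–Čech differential on cochains indexed by all lists instead of the strictly increasing
ones. -/
noncomputable def cechFun (M : ι → BanMod 𝒞 A) (v : ∀ i, M i) (w : ∀ l, tensorList M l)
    (l : List ι) : tensorList M l :=
  ∑ j ∈ Finset.range l.length, (-1 : ℤ) ^ j • coface M v l j (w (l.eraseIdx j))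

/-- The differential of the total derived Tate–Čech complex on cochains indexed by all lists and
homological degrees. -/
noncomputable def derivedCechFun (P : ι → BanComplex 𝒞 A) (e : ∀ i, (P i).X 0)
    (z : ∀ l q, (tensorListC P l).X q) (l : List ι) (q : ℕ) : (tensorListC P l).X q :=
  ∑ j ∈ Finset.range l.length, (-1 : ℤ) ^ j • cofaceC P e l j q (z (l.eraseIdx j) q) +
    (-1 : ℤ) ^ l.length • (tensorListC P l).d q (z l (q + 1))

variable {M : ι → BanMod 𝒞 A} {v : ∀ i, M i} {P : ι → BanComplex 𝒞 A} {e : ∀ i, (P i).X 0}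

theorem cechFun_congr {w w' : ∀ l, tensorList M l} {l : List ι}
    (h : ∀ j < l.length, w (l.eraseIdx j) = w' (l.eraseIdx j)) :
    cechFun M v w l = cechFun M v w' l :=
  Finset.sum_congr rfl fun j hj => by rw [h j (Finset.mem_range.1 hj)]

theorem cechFun_cons (w : ∀ l, tensorList M l) (k : ι) (l : List ι) :
    cechFun M v w (k :: l) = BanMod.tmulLeft (v k) (tensorList M l) (w l) -
      ∑ j ∈ Finset.range l.length, (-1 : ℤ) ^ j •
        (BanHom.id (M k)).tensorMap (coface M v l j) (w (k :: l.eraseIdx j)) := by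
  rw [cechFun, List.length_cons, Finset.sum_range_succ', pow_zero, one_smul, add_comm,
    sub_eq_add_neg, ← Finset.sum_neg_distrib]
  refine congrArg₂ _ rfl (Finset.sum_congr rfl fun j _ => ?_)
  rw [pow_succ, mul_neg_one, neg_smul]
  rfl

theorem cechFun_sum {κ : Type*} (s : Finset κ) (w : κ → ∀ l, tensorList M l) (l : List ι) :
    cechFun M v (fun l => ∑ i ∈ s, w i l) l = ∑ i ∈ s, cechFun M v (w i) l := by
  simp only [cechFun, map_sum, Finset.smul_sum]
  exact Finset.sum_comm

theorem derivedCechFun_congr {z z' : ∀ l q, (tensorListC P l).X q} {l : List ι} {q : ℕ}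
    (h : ∀ j < l.length, z (l.eraseIdx j) q = z' (l.eraseIdx j) q)
    (h' : z l (q + 1) = z' l (q + 1)) :
    derivedCechFun P e z l q = derivedCechFun P e z' l q := by
  rw [derivedCechFun, derivedCechFun, h']
  exact congrArg₂ _ (Finset.sum_congr rfl fun j hj => by rw [h j (Finset.mem_range.1 hj)]) rfl

theorem derivedCechFun_derivedCechFun (z : ∀ l q, (tensorListC P l).X q) (l : List ι) (q : ℕ) :
    derivedCechFun P e (derivedCechFun P e z) l q = 0 := by
  have hcc := (GradedBanFunctor.eval 𝒞 A q).sum_cofaceC_cofaceC P e l fun l => z l q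
  have hcd (j : ℕ) :
      cofaceC P e l j q ((tensorListC P (l.eraseIdx j)).d q (z (l.eraseIdx j) (q + 1))) =
        (tensorListC P l).d q (cofaceC P e l j (q + 1) (z (l.eraseIdx j) (q + 1))) :=
    DFunLike.congr_fun (cofaceC_comp_d P e l j q) _
  have hdd : (tensorListC P l).d q ((tensorListC P l).d (q + 1) (z l (q + 1 + 1))) = 0 :=
    DFunLike.congr_fun ((tensorListC P l).d_comp_d q) _
  simp only [derivedCechFun, map_add, map_sum, map_zsmul, Finset.smul_sum, smul_add,
    Finset.sum_add_distrib, hcd, hdd, smul_zero, add_zero]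
  rw [add_assoc, ← Finset.sum_add_distrib, Finset.sum_eq_zero (s := Finset.range l.length)
    (f := fun j => _ + _), add_zero]
  · refine (Finset.sum_congr rfl fun j hj => ?_).trans hcc
    rw [List.length_eraseIdx_of_lt (Finset.mem_range.1 hj)]
    simp only [mul_smul]
    rfl
  · intro j hj
    have hlen : l.length = (l.eraseIdx j).length + 1 := by
      have := Finset.mem_range.1 hj
      rw [List.length_eraseIdx_of_lt this]
      omega
    rw [smul_comm ((-1 : ℤ) ^ l.length), ← smul_add, ← add_smul, hlen, pow_succ, mul_neg_one,
      add_neg_cancel, zero_smul, smul_zero]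

theorem tensorListAug_derivedCechFun {ε : ∀ i, BanHom ((P i).X 0) (M i)}
    (hε : ∀ i, (ε i).comp ((P i).d 0) = 0) (hv : ∀ i, ε i (e i) = v i)
    (z : ∀ l q, (tensorListC P l).X q) (l : List ι) :
    tensorListAug ε l (derivedCechFun P e z l 0) =
      cechFun M v (fun l => tensorListAug ε l (z l 0)) l := by
  have hd : tensorListAug ε l ((tensorListC P l).d 0 (z l 1)) = 0 :=
    DFunLike.congr_fun (tensorListAug_comp_d hε l) _
  rw [derivedCechFun, map_add, map_zsmul, hd, smul_zero, add_zero, map_sum, cechFun]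
  refine Finset.sum_congr rfl fun j _ => ?_
  rw [map_zsmul]
  exact congrArg _ (DFunLike.congr_fun (tensorListAug_comp_cofaceC hv l j) _)

theorem cechFun_cechFun (w : ∀ l, tensorList M l) (l : List ι) :
    cechFun M v (cechFun M v w) l = 0 := by
  let c i := BanComplex.singleContraction (M i)
  let z (l : List ι) : ∀ q, (tensorListC (fun i => BanComplex.single (M i)) l).X q
    | 0 => (tensorListContraction c l).σ (w l)
    | _ + 1 => 0
  have haug := tensorListAug_derivedCechFun (e := v) (v := v) (fun i => (c i).aug_d) fun _ => rfl
  have hz (l : List ι) : tensorListAug _ l (z l 0) = w l :=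
    (tensorListContraction c l).aug_σ_apply _
  have hdz : (fun l => tensorListAug _ l (derivedCechFun _ v z l 0)) = cechFun M v w :=
    funext fun l => (haug z l).trans (by simp only [hz])
  rw [← hdz, ← haug]
  exact (congrArg _ (derivedCechFun_derivedCechFun z l 0)).trans (map_zero _)

end CechFun

/-! ### Splittings of the Tate–Čech complex -/

section Contract

variable {𝒞 : BanachKind} {A : Type u} [BanachRing A]

/-- Multiplication by a scalar, as a morphism. -/
def BanHom.scalar (N : BanMod 𝒞 A) (a : A) : BanHom N N where
  toLinearMap := LinearMap.lsmul A N a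
  exists_bound :=
    let ⟨C, hC⟩ := N.exists_smul_bound
    ⟨C * ‖a‖, hC a⟩

namespace BanMod

variable [IsOfKind 𝒞 A] {M : BanMod 𝒞 A} (φ : BanHom M (BanMod.regular 𝒞 A))

/-- The contraction `M ⊗̂ N → N`, `m ⊗ n ↦ φ m • n`, of the first tensor factor by a functional. -/
noncomputable def contract (N : BanMod 𝒞 A) : BanHom (M.tensor N) N :=
  BanMod.tensorLift ((LinearMap.lsmul A N).comp φ.toLinearMap) (by
    obtain ⟨C, -, hφ⟩ := φ.bound
    obtain ⟨D, hD, hN⟩ := N.smul_bound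
    refine ⟨D * C, fun m n => (hN (φ m) n).trans ?_⟩
    calc D * ‖φ m‖ * ‖n‖ ≤ D * (C * ‖m‖) * ‖n‖ := by
          gcongr
          exact hφ m
      _ = D * C * (‖m‖ * ‖n‖) := by ring)

theorem contract_tmul {N : BanMod 𝒞 A} (m : M) (n : N) :
    contract φ N (M.tmul N m n) = (show A from φ m) • n :=
  BanMod.tensorLift_tmul _ _ m n

theorem contract_comp_id_tensorMap {N N' : BanMod 𝒞 A} (f : BanHom N N') :
    (contract φ N').comp ((BanHom.id M).tensorMap f) = f.comp (contract φ N) :=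
  BanMod.tensor_hom_ext fun m n => by
    rw [BanHom.comp_apply, BanHom.comp_apply, BanHom.tensorMap_tmul, contract_tmul, contract_tmul,
      map_smul, BanHom.id_apply]

end BanMod

end Contract

/-- Functionals `φ i : M i → A` which split the Tate–Čech complex of modules `M i` with
distinguished elements `v i`: their values at the `v i` form a partition of unity by weights, and
they invert the maps `v i ⊗ -` up to these weights. The vanishing for `k < i` makes the
homotopy built from the `φ i` compatible with restricting to strictly increasing indices. -/
structure CechSplitting {𝒞 : BanachKind} {A : Type u} [BanachRing A] [IsOfKind 𝒞 A] {m : ℕ}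
    (M : Fin m → BanMod 𝒞 A) (v : ∀ i, M i) where
  φ : ∀ i, BanHom (M i) (BanMod.regular 𝒞 A)
  weight : Fin m → A
  φ_v : ∀ i, φ i (v i) = weight i
  φ_smul_v : ∀ i (b : M i), (show A from φ i b) • v i = weight i • b
  φ_smul_of_lt : ∀ i k, k < i → ∀ (b : M i) (c : M k), (show A from φ i b) • c = 0
  sum_weight : ∑ i, weight i = 1

namespace CechSplitting

variable {𝒞 : BanachKind} {A : Type u} [BanachRing A] [IsOfKind 𝒞 A] {m : ℕ}
  {M : Fin m → BanMod 𝒞 A} {v : ∀ i, M i} (S : CechSplitting M v)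

theorem contract_tmulLeft (i : Fin m) {N : BanMod 𝒞 A} (n : N) :
    BanMod.contract (S.φ i) N (BanMod.tmulLeft (v i) N n) = S.weight i • n := by
  refine (BanMod.contract_tmul _ _ _).trans ?_
  rw [S.φ_v]

theorem tmulLeft_contract (i : Fin m) {N : BanMod 𝒞 A} (x : (M i).tensor N) :
    BanMod.tmulLeft (v i) N (BanMod.contract (S.φ i) N x) = S.weight i • x := by
  have h : (BanMod.tmulLeft (v i) N).comp (BanMod.contract (S.φ i) N) =
      BanHom.scalar _ (S.weight i) := BanMod.tensor_hom_ext fun b n => by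
    rw [BanHom.comp_apply, BanMod.contract_tmul, map_smul]
    change _ • (M i).tmul N (v i) n = S.weight i • (M i).tmul N b n
    rw [← LinearMap.smul_apply, ← map_smul, S.φ_smul_v, map_smul, LinearMap.smul_apply]
  exact DFunLike.congr_fun h x

theorem tmulLeft_contract_of_lt {i k : Fin m} (hk : k < i) {N : BanMod 𝒞 A}
    (x : (M i).tensor N) : BanMod.tmulLeft (v k) N (BanMod.contract (S.φ i) N x) = 0 := by
  have h : (BanMod.tmulLeft (v k) N).comp (BanMod.contract (S.φ i) N) = 0 :=
    BanMod.tensor_hom_ext fun b n => by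
      rw [BanHom.comp_apply, BanMod.contract_tmul, map_smul]
      change _ • (M k).tmul N (v k) n = 0
      rw [← LinearMap.smul_apply, ← map_smul, S.φ_smul_of_lt i k hk, map_zero,
        LinearMap.zero_apply]
  exact DFunLike.congr_fun h x

theorem weight_smul_of_lt {i k : Fin m} (hk : k < i) {N : BanMod 𝒞 A} (x : (M k).tensor N) :
    S.weight i • x = 0 := by
  have hsmul (b : M k) : S.weight i • b = 0 := by
    rw [← S.φ_v]
    exact S.φ_smul_of_lt i k hk (v i) b
  have h : BanHom.scalar ((M k).tensor N) (S.weight i) = 0 :=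
    BanMod.tensor_hom_ext fun b n => by
      change S.weight i • (M k).tmul N b n = 0
      rw [← LinearMap.smul_apply, ← map_smul, hsmul, map_zero, LinearMap.zero_apply]
  exact DFunLike.congr_fun h x

/-- The contracting homotopy of the Tate–Čech complex, on cochains indexed by all lists. -/
noncomputable def homotopy (w : ∀ l, tensorList M l) (l : List (Fin m)) : tensorList M l :=
  ∑ i, BanMod.contract (S.φ i) (tensorList M l) (w (i :: l))

theorem cechFun_contract_of_cechFun_cons_eq_zero (w : ∀ l, tensorList M l) (i : Fin m)
    (l : List (Fin m)) (hw : cechFun M v w (i :: l) = 0) :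
    cechFun M v (fun l => BanMod.contract (S.φ i) (tensorList M l) (w (i :: l))) l =
      S.weight i • w l := by
  have h := sub_eq_zero.1 ((cechFun_cons w i l).symm.trans hw)
  rw [← S.contract_tmulLeft i (w l), h, map_sum, cechFun]
  refine Finset.sum_congr rfl fun j _ => ?_
  rw [map_zsmul]
  exact congrArg _ (DFunLike.congr_fun
    (BanMod.contract_comp_id_tensorMap (S.φ i) (coface M v l j)) (w (i :: l.eraseIdx j))).symm

theorem cechFun_contract_of_not_pairwise_cons {w : ∀ l, tensorList M l}
    (hw : ∀ l, ¬ l.Pairwise (· < ·) → w l = 0) {i : Fin m} {l : List (Fin m)}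
    (hl : l.Pairwise (· < ·)) (hi : ¬ (i :: l).Pairwise (· < ·)) :
    cechFun M v (fun l => BanMod.contract (S.φ i) (tensorList M l) (w (i :: l))) l =
      S.weight i • w l := by
  rcases l with _ | ⟨k, l⟩
  · exact absurd (List.pairwise_singleton _ _) hi
  have hki : k ≤ i := not_lt.1 fun hik => hi (List.pairwise_cons_cons_iff_of_trans.2 ⟨hik, hl⟩)
  have hzero (l' : List (Fin m)) : BanMod.contract (S.φ i) _ (w (i :: k :: l')) = 0 :=
    (congrArg _ (hw _ fun h => (List.pairwise_cons_cons_iff_of_trans.1 h).1.not_ge hki)).trans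
      (map_zero _)
  rw [cechFun_cons, Finset.sum_eq_zero, sub_zero]
  · rcases hki.lt_or_eq with hlt | rfl
    · exact (S.tmulLeft_contract_of_lt hlt _).trans (S.weight_smul_of_lt hlt (w (k :: l))).symm
    · exact S.tmulLeft_contract k _
  · intro j _
    rw [hzero]
    exact (congrArg _ (map_zero _)).trans (smul_zero _)

theorem cechFun_homotopy {w : ∀ l, tensorList M l} (hw : ∀ l, ¬ l.Pairwise (· < ·) → w l = 0)
    {l : List (Fin m)} (hl : l.Pairwise (· < ·))
    (hcocycle : ∀ i, (i :: l).Pairwise (· < ·) → cechFun M v w (i :: l) = 0) :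
    cechFun M v (S.homotopy w) l = w l := by
  have hterm (i : Fin m) :
      cechFun M v (fun l => BanMod.contract (S.φ i) (tensorList M l) (w (i :: l))) l =
        S.weight i • w l := by
    by_cases hi : (i :: l).Pairwise (· < ·)
    · exact S.cechFun_contract_of_cechFun_cons_eq_zero w i l (hcocycle i hi)
    · exact S.cechFun_contract_of_not_pairwise_cons hw hl hi
  refine (cechFun_sum _ _ _).trans ?_
  rw [Finset.sum_congr rfl fun i _ => hterm i, ← Finset.sum_smul, S.sum_weight, one_smul]

end CechSplitting

section TateAcyclic

variable {𝒞 : BanachKind} {A : Type u} [BanachRing A] [IsOfKind 𝒞 A] {m : ℕ}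

/-- The component of a Tate–Čech cochain at a list, extended by zero to the lists which do not
index a factor of `cechX B p`. -/
noncomputable def cechProj (B : Fin m → BanAlg 𝒞 A) (p : ℕ) (l : List (Fin m)) :
    BanHom (cechX B p) (tensorList (fun i => (B i).toMod) l) :=
  if h : l.Pairwise (· < ·) ∧ l.length = p then
    BanMod.proj (fun l : CechIdx m p => tensorList (fun i => (B i).toMod) l.1) ⟨l, h⟩
  else 0

variable {B : Fin m → BanAlg 𝒞 A} {p : ℕ}

theorem cechProj_coe (l : CechIdx m p) : cechProj B p l.1 =
    BanMod.proj (fun l : CechIdx m p => tensorList (fun i => (B i).toMod) l.1) l :=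
  dif_pos l.2

theorem cechProj_of_not_pairwise {l : List (Fin m)} (hl : ¬ l.Pairwise (· < ·)) :
    cechProj B p l = 0 :=
  dif_neg fun h => hl h.1

theorem cechX_ext {x y : cechX B p}
    (h : ∀ l : CechIdx m p, cechProj B p l.1 x = cechProj B p l.1 y) : x = y :=
  funext fun l => by
    have hl := h l
    rwa [cechProj_coe] at hl

theorem cechProj_cechD (x : cechX B p) (l : CechIdx m (p + 1)) :
    cechProj B (p + 1) l.1 (cechD B p x) =
      cechFun (fun i => (B i).toMod) (fun i => (B i).unitElt) (fun l => cechProj B p l x) l.1 := by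
  rw [cechProj_coe]
  refine (BanHom.sum_apply _ _ _).trans ?_
  rw [cechFun, Finset.sum_range]
  refine Finset.sum_congr rfl fun j _ => (BanHom.zsmul_apply _ _ _).trans ?_
  rw [cechProj_coe ⟨l.1.eraseIdx j, l.2.1.sublist (List.eraseIdx_sublist _ _), by
    rw [List.length_eraseIdx_of_lt j.2, l.2.2, Nat.add_sub_cancel]⟩]
  rfl

theorem cechD_comp_cechD : (cechD B (p + 1)).comp (cechD B p) = 0 := by
  refine BanHom.ext fun x => cechX_ext fun l => ?_
  refine (cechProj_cechD _ l).trans (((cechFun_congr fun j hj => ?_).trans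
    (cechFun_cechFun (fun l => cechProj B p l x) l.1)).trans (map_zero _).symm)
  exact cechProj_cechD x ⟨l.1.eraseIdx j, l.2.1.sublist (List.eraseIdx_sublist _ _), by
    rw [List.length_eraseIdx_of_lt hj, l.2.2, Nat.add_sub_cancel]⟩

namespace CechSplitting

variable (S : CechSplitting (fun i => (B i).toMod) (fun i => (B i).unitElt))

/-- The contracting homotopy of the Tate–Čech complex. -/
noncomputable def cechHomotopy (p : ℕ) : BanHom (cechX B (p + 1)) (cechX B p) :=
  BanMod.piLift fun l : CechIdx m p => ∑ i,
    (BanMod.contract (S.φ i) (tensorList (fun i => (B i).toMod) l.1)).comp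
      (cechProj B (p + 1) (i :: l.1))

theorem cechProj_cechHomotopy (x : cechX B (p + 1)) (l : CechIdx m p) :
    cechProj B p l.1 (S.cechHomotopy p x) = S.homotopy (fun l => cechProj B (p + 1) l x) l.1 := by
  rw [cechProj_coe]
  exact BanHom.sum_apply _ _ _

theorem cechFun_homotopy_cechProj {x : cechX B p} (hx : cechD B p x = 0) (l : CechIdx m p) :
    cechFun (fun i => (B i).toMod) (fun i => (B i).unitElt)
      (S.homotopy fun l => cechProj B p l x) l.1 = cechProj B p l.1 x := by
  refine S.cechFun_homotopy (w := fun l => cechProj B p l x)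
    (fun l hl => by rw [cechProj_of_not_pairwise hl, BanHom.zero_apply]) l.2.1 fun i hi => ?_
  rw [← cechProj_cechD x ⟨i :: l.1, hi, congrArg (· + 1) l.2.2⟩, hx, map_zero]

end CechSplitting

theorem CechSplitting.tateAcyclic
    (S : CechSplitting (fun i => (B i).toMod) (fun i => (B i).unitElt)) : TateAcyclic B := by
  refine ⟨.of_section_on_ker (BanHom.comp_zero _) 0 fun x hx => cechX_ext fun l => ?_,
    fun p => .of_section_on_ker cechD_comp_cechD (S.cechHomotopy p)
      fun x hx => cechX_ext fun l => ?_⟩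
  · rw [BanHom.zero_apply, map_zero, ← S.cechFun_homotopy_cechProj hx l, cechFun, l.2.2]
    rfl
  · refine ((cechProj_cechD _ l).trans (cechFun_congr fun j hj => ?_)).trans
      (S.cechFun_homotopy_cechProj hx l)
    exact S.cechProj_cechHomotopy x ⟨l.1.eraseIdx j, l.2.1.sublist (List.eraseIdx_sublist _ _), by
      rw [List.length_eraseIdx_of_lt hj, l.2.2, Nat.add_sub_cancel]⟩

end TateAcyclic

/-! ### Splittings of the derived Tate–Čech complex -/

section DerivedHomotopy

variable {𝒞 : BanachKind} {A : Type u} [BanachRing A] [IsOfKind 𝒞 A] {m : ℕ}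
  {P : Fin m → BanComplex 𝒞 A} {e : ∀ i, (P i).X 0} {M : Fin m → BanMod 𝒞 A} {v : ∀ i, M i}
  {ε : ∀ i, BanHom ((P i).X 0) (M i)}

namespace CechSplitting

variable (S : CechSplitting M v) (c : ∀ i, (P i).Contraction (ε i))

/-- The operator on derived Tate–Čech cochains, indexed by all lists and homological degrees, which
combines the homotopy of the Tate–Čech complex in homological degree `0` with the contractions of
the columns. -/
noncomputable def derivedHomotopy (z : ∀ l q, (tensorListC P l).X q) (l : List (Fin m)) :
    ∀ q, (tensorListC P l).X q
  | 0 => (tensorListContraction c l).σ (S.homotopy (fun l => tensorListAug ε l (z l 0)) l)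
  | q + 1 => (-1 : ℤ) ^ l.length • (tensorListContraction c l).s q (z l q)

theorem derivedHomotopy_eq_zero {z : ∀ l q, (tensorListC P l).X q} {l : List (Fin m)}
    (hz : ∀ q, z l q = 0) (haug : ∀ i, tensorListAug ε (i :: l) (z (i :: l) 0) = 0) (q : ℕ) :
    S.derivedHomotopy c z l q = 0 := by
  rcases q with _ | q
  · have h : S.homotopy (fun l => tensorListAug ε l (z l 0)) l = 0 :=
      Finset.sum_eq_zero fun i _ => (congrArg _ (haug i)).trans (map_zero _)
    rw [derivedHomotopy, h, map_zero]
  · rw [derivedHomotopy, hz, map_zero, smul_zero]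

theorem tensorListAug_derivedCechFun_derivedHomotopy (hv : ∀ i, ε i (e i) = v i)
    {z : ∀ l q, (tensorListC P l).X q} (hz : ∀ l, ¬ l.Pairwise (· < ·) → z l 0 = 0)
    {l : List (Fin m)} (hl : l.Pairwise (· < ·))
    (hcocycle : ∀ i, (i :: l).Pairwise (· < ·) → derivedCechFun P e z (i :: l) 0 = 0) :
    tensorListAug ε l (derivedCechFun P e (S.derivedHomotopy c z) l 0) =
      tensorListAug ε l (z l 0) := by
  have haug := tensorListAug_derivedCechFun (fun i => (c i).aug_d) hv
  rw [haug]
  refine (cechFun_congr fun j _ => (tensorListContraction c _).aug_σ_apply _).trans ?_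
  refine S.cechFun_homotopy (w := fun l => tensorListAug ε l (z l 0))
    (fun l hl => by rw [hz l hl, map_zero]) hl fun i hi => ?_
  rw [← haug, hcocycle i hi, map_zero]

theorem derivedCechFun_derivedHomotopy {z : ∀ l q, (tensorListC P l).X q} {l : List (Fin m)}
    (hshort : ∀ l', l'.length < l.length → ∀ q, z l' q = 0)
    (haug : ∀ l, tensorListAug ε l (z l 0) = 0) {q : ℕ}
    (hcocycle : ∀ p, p + 1 = q → derivedCechFun P e z l p = 0) :
    derivedCechFun P e (S.derivedHomotopy c z) l q = z l q := by
  have hface {z' : ∀ l q, (tensorListC P l).X q} (q : ℕ)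
      (hz' : ∀ l', l'.length < l.length → z' l' q = 0) :
      derivedCechFun P e z' l q = (-1 : ℤ) ^ l.length • (tensorListC P l).d q (z' l (q + 1)) := by
    refine add_eq_right.2 (Finset.sum_eq_zero fun j hj => ?_)
    have hlt : (l.eraseIdx j).length < l.length := by
      have := Finset.mem_range.1 hj
      rw [List.length_eraseIdx_of_lt this]
      omega
    rw [hz' _ hlt, map_zero, smul_zero]
  have hsign : IsUnit ((-1 : ℤ) ^ l.length) := (isUnit_one.neg).pow _
  rw [hface q fun l' hl' => S.derivedHomotopy_eq_zero c (hshort l' hl') (fun i => haug _) q,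
    derivedHomotopy, map_zsmul, smul_smul, Int.isUnit_mul_self hsign, one_smul]
  rcases q with _ | q
  · simpa only [haug, map_zero, zero_add] using
      (tensorListContraction c l).zero_apply (z l 0)
  · have hd : (tensorListC P l).d q (z l (q + 1)) = 0 := by
      have h := (hface q fun l' hl' => hshort l' hl' q).symm.trans (hcocycle q rfl)
      simpa only [smul_smul, Int.isUnit_mul_self hsign, one_smul, smul_zero] using
        congrArg ((-1 : ℤ) ^ l.length • ·) h
    simpa only [hd, map_zero, zero_add] using
      (tensorListContraction c l).succ_apply q (z l (q + 1))

end CechSplitting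

end DerivedHomotopy

section DerivedAcyclic

variable {𝒞 : BanachKind} {A : Type u} [BanachRing A] [IsOfKind 𝒞 A] {m : ℕ}

/-- The component of a derived Tate–Čech cochain at a list and a homological degree, extended by
zero to the pairs which do not index a factor of `derivedCechX P n`. -/
noncomputable def derivedCechProj (P : Fin m → BanComplex 𝒞 A) (n : ℤ) (l : List (Fin m)) (q : ℕ) :
    BanHom (derivedCechX P n) ((tensorListC P l).X q) :=
  if h : l.Pairwise (· < ·) ∧ (l.length : ℤ) - q = n then
    BanMod.proj (fun y : DerivedCechIdx m n => (tensorListC P y.1.1).X y.1.2) ⟨(l, q), h⟩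
  else 0

variable {P : Fin m → BanComplex 𝒞 A} {e : ∀ i, (P i).X 0} {n : ℤ}

theorem derivedCechProj_coe (y : DerivedCechIdx m n) : derivedCechProj P n y.1.1 y.1.2 =
    BanMod.proj (fun y : DerivedCechIdx m n => (tensorListC P y.1.1).X y.1.2) y :=
  dif_pos y.2

theorem derivedCechProj_of_not {l : List (Fin m)} {q : ℕ}
    (h : ¬ (l.Pairwise (· < ·) ∧ (l.length : ℤ) - q = n)) : derivedCechProj P n l q = 0 :=
  dif_neg h

theorem derivedCechX_ext {x y : derivedCechX P n} (h : ∀ (l) (q : ℕ), l.Pairwise (· < ·) →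
    (l.length : ℤ) - q = n → derivedCechProj P n l q x = derivedCechProj P n l q y) : x = y :=
  funext fun i => by
    have hi := h i.1.1 i.1.2 i.2.1 i.2.2
    rwa [derivedCechProj_coe] at hi

theorem derivedCechProj_derivedCechD (x : derivedCechX P n) {l : List (Fin m)} {q : ℕ}
    (hl : l.Pairwise (· < ·)) (hq : (l.length : ℤ) - q = n + 1) :
    derivedCechProj P (n + 1) l q (derivedCechD P e n x) =
      derivedCechFun P e (fun l q => derivedCechProj P n l q x) l q := by
  rw [derivedCechProj_coe ⟨(l, q), hl, hq⟩]
  refine (BanHom.add_apply _ _ x).trans (congrArg₂ (· + ·) ((BanHom.sum_apply _ _ _).trans ?_) ?_)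
  · rw [Finset.sum_range]
    refine Finset.sum_congr rfl fun j _ => (BanHom.zsmul_apply _ _ _).trans ?_
    refine congrArg _ (congrArg (cofaceC P e l j q) ?_)
    have hj : (j : ℕ) < l.length := j.2
    exact (DFunLike.congr_fun (derivedCechProj_coe ⟨(l.eraseIdx j, q),
      hl.sublist (List.eraseIdx_sublist _ _), by
        simp only [List.length_eraseIdx_of_lt hj]
        omega⟩) x).symm
  · refine (BanHom.zsmul_apply _ _ _).trans (congrArg _ (congrArg ((tensorListC P l).d q) ?_))
    exact (DFunLike.congr_fun (derivedCechProj_coe ⟨(l, q + 1), hl, by push_cast; omega⟩) x).symm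

theorem derivedCechD_comp_derivedCechD :
    (derivedCechD P e (n + 1)).comp (derivedCechD P e n) = 0 := by
  refine BanHom.ext fun x => derivedCechX_ext fun l q hl hq => ?_
  refine (derivedCechProj_derivedCechD _ hl hq).trans (((derivedCechFun_congr (fun j hj => ?_)
    ?_).trans (derivedCechFun_derivedCechFun (fun l q => derivedCechProj P n l q x) l q)).trans
      (map_zero _).symm)
  · refine derivedCechProj_derivedCechD x (hl.sublist (List.eraseIdx_sublist _ _)) ?_
    rw [List.length_eraseIdx_of_lt hj]
    omega
  · refine derivedCechProj_derivedCechD x hl ?_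
    push_cast
    omega

theorem derivedCechFun_derivedCechProj_eq_zero {x : derivedCechX P n}
    (hx : derivedCechD P e n x = 0) {l : List (Fin m)} {q : ℕ} (hl : l.Pairwise (· < ·))
    (hq : (l.length : ℤ) - q = n + 1) :
    derivedCechFun P e (fun l q => derivedCechProj P n l q x) l q = 0 := by
  rw [← derivedCechProj_derivedCechD x hl hq, hx, map_zero]

variable {M : Fin m → BanMod 𝒞 A} {v : ∀ i, M i} {ε : ∀ i, BanHom ((P i).X 0) (M i)}

namespace CechSplitting

variable (S : CechSplitting M v) (c : ∀ i, (P i).Contraction (ε i))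

/-- The component of `CechSplitting.derivedCechHomotopy` at a list and a homological degree. -/
noncomputable def derivedHomotopyHom (n : ℤ) (l : List (Fin m)) :
    ∀ q, BanHom (derivedCechX P (n + 1)) ((tensorListC P l).X q)
  | 0 => (tensorListContraction c l).σ.comp (∑ i,
      (BanMod.contract (S.φ i) (tensorList M l)).comp
        ((tensorListAug ε (i :: l)).comp (derivedCechProj P (n + 1) (i :: l) 0)))
  | q + 1 =>
    (-1 : ℤ) ^ l.length • ((tensorListContraction c l).s q).comp (derivedCechProj P (n + 1) l q)

theorem derivedHomotopyHom_apply (x : derivedCechX P (n + 1)) (l : List (Fin m)) (q : ℕ) :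
    S.derivedHomotopyHom c n l q x =
      S.derivedHomotopy c (fun l q => derivedCechProj P (n + 1) l q x) l q := by
  rcases q with _ | q
  · exact congrArg (tensorListContraction c l).σ (BanHom.sum_apply _ _ _)
  · exact BanHom.zsmul_apply _ _ _

/-- The operator `CechSplitting.derivedHomotopy` on the total derived Tate–Čech complex. It is a
contracting homotopy up to cochains of higher Čech degree. -/
noncomputable def derivedCechHomotopy (n : ℤ) :
    BanHom (derivedCechX P (n + 1)) (derivedCechX P n) :=
  BanMod.piLift fun y : DerivedCechIdx m n => S.derivedHomotopyHom c n y.1.1 y.1.2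

theorem derivedCechProj_derivedCechHomotopy (x : derivedCechX P (n + 1)) (l : List (Fin m))
    (q : ℕ) : derivedCechProj P n l q (S.derivedCechHomotopy c n x) =
      S.derivedHomotopy c (fun l q => derivedCechProj P (n + 1) l q x) l q := by
  rw [← derivedHomotopyHom_apply]
  by_cases h : l.Pairwise (· < ·) ∧ (l.length : ℤ) - q = n
  · rw [derivedCechProj_coe ⟨(l, q), h⟩]
    rfl
  · rw [derivedCechProj_of_not h, BanHom.zero_apply]
    rcases q with _ | q
    · have hi (i : Fin m) : derivedCechProj P (n + 1) (i :: l) 0 = 0 :=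
        derivedCechProj_of_not fun hi => h ⟨hi.1.of_cons, by
          have := hi.2
          rw [List.length_cons] at this
          push_cast at this ⊢
          omega⟩
      rw [derivedHomotopyHom, Finset.sum_eq_zero fun i _ => by
        rw [hi, BanHom.comp_zero]
        exact BanHom.comp_zero _, BanHom.comp_zero, BanHom.zero_apply]
    · rw [derivedHomotopyHom, derivedCechProj_of_not fun h' => h ⟨h'.1, by
        have := h'.2
        push_cast
        omega⟩, BanHom.comp_zero, smul_zero, BanHom.zero_apply]

/-- The failure `x - d (h x)` of the operator `h` of `CechSplitting.derivedCechHomotopy` to be a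
contracting homotopy at the cocycle `x`. -/
noncomputable def homotopyDefect (e : ∀ i, (P i).X 0) (n : ℤ) (x : derivedCechX P (n + 1)) :
    derivedCechX P (n + 1) :=
  x - derivedCechD P e n (S.derivedCechHomotopy c n x)

theorem derivedCechD_homotopyDefect {x : derivedCechX P (n + 1)}
    (hx : derivedCechD P e (n + 1) x = 0) :
    derivedCechD P e (n + 1) (S.homotopyDefect c e n x) = 0 := by
  have h : derivedCechD P e (n + 1) (derivedCechD P e n (S.derivedCechHomotopy c n x)) = 0 :=
    DFunLike.congr_fun derivedCechD_comp_derivedCechD _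
  rw [homotopyDefect, map_sub, hx, h, sub_zero]

theorem derivedCechProj_homotopyDefect (x : derivedCechX P (n + 1)) {l : List (Fin m)} {q : ℕ}
    (hl : l.Pairwise (· < ·)) (hq : (l.length : ℤ) - q = n + 1) :
    derivedCechProj P (n + 1) l q (S.homotopyDefect c e n x) = derivedCechProj P (n + 1) l q x -
      derivedCechFun P e (S.derivedHomotopy c fun l q => derivedCechProj P (n + 1) l q x) l q := by
  rw [homotopyDefect, map_sub, derivedCechProj_derivedCechD _ hl hq]
  simp only [derivedCechProj_derivedCechHomotopy]

theorem tensorListAug_homotopyDefect (hv : ∀ i, ε i (e i) = v i) {x : derivedCechX P (n + 1)}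
    (hx : derivedCechD P e (n + 1) x = 0) (l : List (Fin m)) :
    tensorListAug ε l (derivedCechProj P (n + 1) l 0 (S.homotopyDefect c e n x)) = 0 := by
  by_cases h : l.Pairwise (· < ·) ∧ (l.length : ℤ) - (0 : ℕ) = n + 1
  · rw [S.derivedCechProj_homotopyDefect c x h.1 h.2, map_sub, sub_eq_zero]
    refine (S.tensorListAug_derivedCechFun_derivedHomotopy c hv (fun l hl => ?_) h.1
      fun i hi => derivedCechFun_derivedCechProj_eq_zero hx hi ?_).symm
    · rw [derivedCechProj_of_not fun h => hl h.1, BanHom.zero_apply]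
    · rw [List.length_cons]
      push_cast
      exact congrArg (· + 1) h.2
  · rw [derivedCechProj_of_not h, BanHom.zero_apply, map_zero]

theorem derivedCechProj_homotopyDefect_eq_zero {x : derivedCechX P (n + 1)} {k : ℕ}
    (hx : derivedCechD P e (n + 1) x = 0)
    (haug : ∀ l, tensorListAug ε l (derivedCechProj P (n + 1) l 0 x) = 0)
    (hk : ∀ l q, l.length < k → derivedCechProj P (n + 1) l q x = 0) {l : List (Fin m)}
    (hl : l.length < k + 1) (q : ℕ) :
    derivedCechProj P (n + 1) l q (S.homotopyDefect c e n x) = 0 := by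
  by_cases h : l.Pairwise (· < ·) ∧ (l.length : ℤ) - q = n + 1
  · rw [S.derivedCechProj_homotopyDefect c x h.1 h.2, sub_eq_zero]
    refine (S.derivedCechFun_derivedHomotopy c (fun l' hl' q => hk l' q (by omega)) haug
      fun p hp => derivedCechFun_derivedCechProj_eq_zero hx h.1 ?_).symm
    have := h.2
    push_cast [← hp] at this
    omega
  · rw [derivedCechProj_of_not h, BanHom.zero_apply]

theorem homotopyDefect_iterate (hv : ∀ i, ε i (e i) = v i) {x : derivedCechX P (n + 1)}
    (hx : derivedCechD P e (n + 1) x = 0) (k : ℕ) :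
    derivedCechD P e (n + 1) ((S.homotopyDefect c e n)^[k + 1] x) = 0 ∧
    (∀ l, tensorListAug ε l
      (derivedCechProj P (n + 1) l 0 ((S.homotopyDefect c e n)^[k + 1] x)) = 0) ∧
    ∀ l q, l.length < k →
      derivedCechProj P (n + 1) l q ((S.homotopyDefect c e n)^[k + 1] x) = 0 := by
  induction k with
  | zero =>
    exact ⟨S.derivedCechD_homotopyDefect c hx, S.tensorListAug_homotopyDefect c hv hx,
      fun _ _ h => absurd h (Nat.not_lt_zero _)⟩
  | succ k ih =>
    obtain ⟨hcocycle, haug, hk⟩ := ih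
    rw [Function.iterate_succ_apply']
    exact ⟨S.derivedCechD_homotopyDefect c hcocycle, S.tensorListAug_homotopyDefect c hv hcocycle,
      fun l q hl => S.derivedCechProj_homotopyDefect_eq_zero c hcocycle haug hk hl q⟩

end CechSplitting

theorem CechSplitting.strictExactAt_derivedCechD (S : CechSplitting M v)
    (c : ∀ i, (P i).Contraction (ε i)) (hv : ∀ i, ε i (e i) = v i) (n : ℤ) :
    StrictExactAt (derivedCechD P e n) (derivedCechD P e (n + 1)) := by
  refine .of_iterate_eq_zero derivedCechD_comp_derivedCechD (S.derivedCechHomotopy c n) (m + 2)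
    fun x hx => derivedCechX_ext fun l q hl _ => ?_
  have hlen : l.length < m + 1 := by
    have hnodup : l.Nodup := hl.imp fun h => h.ne
    have := hnodup.length_le_card
    rw [Fintype.card_fin] at this
    omega
  exact ((S.homotopyDefect_iterate c hv hx (m + 1)).2.2 l q hlen).trans (map_zero _).symm

theorem CechSplitting.derivedTateAcyclic {B : Fin m → BanAlg 𝒞 A}
    (S : CechSplitting (fun i => (B i).toMod) (fun i => (B i).unitElt))
    (hproj : ∀ i, (B i).toMod.IsProjective) : DerivedTateAcyclic B :=
  ⟨fun i => BanAlg.nonempty_unitalResolution (hproj i), fun P n =>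
    S.strictExactAt_derivedCechD (ε := fun i => (P i).aug)
      (fun i => ((P i).toBanResolution.nonempty_contraction (hproj i)).some)
      (fun i => (P i).aug_one) n⟩

end DerivedAcyclic

/-! ### Covers by quotients by idempotents -/

section Cover

variable {𝒞 : BanachKind} {A : Type u} [BanachRing A] [IsOfKind 𝒞 A]

/-- The splitting of the family `A / e_i A` for idempotents `e_i` with product zero. The weights
`(∏_{k < i} e_k) (1 - e_i)` are orthogonal idempotents which sum to `1 - ∏ e_i`. -/
noncomputable def idempotentCechSplitting (𝒞 : BanachKind) [IsOfKind 𝒞 A] {m : ℕ} {e : Fin m → A}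
    (he : ∀ i, IsIdempotentElem (e i)) (hprod : ∏ i, e i = 0) :
    CechSplitting (fun i => (BanAlg.idempotentQuotient 𝒞 (he i)).toMod)
      (fun i => (BanAlg.idempotentQuotient 𝒞 (he i)).unitElt) :=
  let a (i : Fin m) : A := ∏ k with k < i, e k
  have hφ (i : Fin m) (t : A) : BanHom.scalar (BanMod.regular 𝒞 A) (a i)
      (BanAlg.idempotentSection (he i) (t • BanAlg.unitElt _)) = (a i * (t * (1 - e i)) : A) := by
    rw [map_smul, BanAlg.idempotentSection_unitElt]
    rfl
  have hsmul (i : Fin m) := BanAlg.exists_smul_unitElt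
    (BanAlg.algebraMap_idempotentQuotient_surjective (𝒞 := 𝒞) (he i))
  { φ := fun i => (BanHom.scalar _ (a i)).comp (BanAlg.idempotentSection (he i))
    weight := fun i => a i * (1 - e i)
    φ_v := fun i => by
      rw [BanHom.comp_apply, BanAlg.idempotentSection_unitElt]
      rfl
    φ_smul_v := fun i b => by
      obtain ⟨t, rfl⟩ := hsmul i b
      rw [BanHom.comp_apply, hφ, smul_smul]
      exact congrArg (· • BanAlg.unitElt _) (by ring)
    φ_smul_of_lt := fun i k hk b c => by
      obtain ⟨t, rfl⟩ := hsmul i b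
      obtain ⟨r, rfl⟩ := hsmul k c
      obtain ⟨s, hs⟩ : e k ∣ a i := Finset.dvd_prod_of_mem _ (by simpa using hk)
      rw [BanHom.comp_apply, hφ, hs, smul_smul,
        show e k * s * (t * (1 - e i)) * r = s * (t * (1 - e i)) * r * e k by ring, mul_smul,
        BanAlg.smul_unitElt_idempotentQuotient, smul_zero]
    sum_weight := by
      have h := Finset.prod_one_sub_ordered Finset.univ fun i => 1 - e i
      simp only [sub_sub_cancel, hprod] at h
      exact (Finset.sum_congr rfl fun i _ => mul_comm _ _).trans (sub_eq_zero.1 h.symm).symm }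

theorem isDerivedCover_and_isNonDerivedCover_quotient_span_singleton (s : Finset A)
    (hs : ∀ e ∈ s, IsIdempotentElem e) (hprod : ∏ e ∈ s, e = 0) :
    IsDerivedCover {B : BanAlg 𝒞 A | ∃ e ∈ s,
      ∃ h : IsClosed ((Ideal.span {e} : Ideal A) : Set A),
        B = BanAlg.quotient 𝒞 (Ideal.span {e}) h} ∧
    IsNonDerivedCover {B : BanAlg 𝒞 A | ∃ e ∈ s,
      ∃ h : IsClosed ((Ideal.span {e} : Ideal A) : Set A),
        B = BanAlg.quotient 𝒞 (Ideal.span {e}) h} := by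
  let f (i : Fin s.card) : A := s.equivFin.symm i
  have hf (i) : IsIdempotentElem (f i) := hs _ (s.equivFin.symm i).2
  have hf_prod : ∏ i, f i = 0 := by
    rw [← hprod, ← Finset.prod_coe_sort s fun e => e]
    exact Equiv.prod_comp s.equivFin.symm fun e : s => (e : A)
  have hinj : Function.Injective fun i => BanAlg.idempotentQuotient 𝒞 (hf i) := fun i j h =>
    s.equivFin.symm.injective (Subtype.ext (BanAlg.idempotentQuotient_inj (hf i) (hf j) h))
  have S := idempotentCechSplitting 𝒞 hf hf_prod
  refine ⟨⟨?_, s.card, _, hinj, fun i => ⟨f i, (s.equivFin.symm i).2, _, rfl⟩,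
      S.derivedTateAcyclic fun i => BanAlg.isProjective_idempotentQuotient (hf i)⟩,
    ?_, s.card, _, hinj, fun i => ⟨f i, (s.equivFin.symm i).2, _, rfl⟩, S.tateAcyclic⟩
  · rintro _ ⟨e, he, -, rfl⟩
    exact BanAlg.isHomotopyEpi_idempotentQuotient (hs e he)
  · rintro _ ⟨e, -, h, rfl⟩
    exact BanAlg.isEpi_of_surjective (BanAlg.algebraMap_quotient_surjective h)

end Cover

theorem prod_eq_zero_of_sum_eq_one {R : Type*} [CommRing R] {s : Finset R}
    (h : ∀ e ∈ s, ∀ f ∈ s, e ≠ f → e * f = 0) (hsum : ∑ e ∈ s, e = 1)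
    (hs : s ≠ {1} ∨ Subsingleton R) : ∏ e ∈ s, e = 0 := by
  classical
  rcases hs with hs | hs
  · rcases s.eq_empty_or_nonempty with rfl | ⟨a, ha⟩
    · rw [Finset.prod_empty, ← hsum, Finset.sum_empty]
    · obtain ⟨b, hb, hba⟩ : ∃ b ∈ s, b ≠ a := by
        by_contra! hb
        obtain rfl := Finset.eq_singleton_iff_unique_mem.2 ⟨ha, hb⟩
        rw [Finset.sum_singleton] at hsum
        exact hs (congrArg _ hsum)
      rw [← Finset.mul_prod_erase s _ ha,
        ← Finset.mul_prod_erase _ _ (Finset.mem_erase.2 ⟨hba, hb⟩), ← mul_assoc,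
        h a ha b hb hba.symm, zero_mul]
  · exact Subsingleton.elim _ _

theorem prod_one_sub_eq_zero_of_sum_eq_one {R : Type*} [CommRing R] {s : Finset R}
    (hs : ∀ e ∈ s, IsIdempotentElem e) (h : ∀ e ∈ s, ∀ f ∈ s, e ≠ f → e * f = 0)
    (hsum : ∑ e ∈ s, e = 1) : ∏ e ∈ s, (1 - e) = 0 := by
  have horth : OrthogonalIdempotents fun e : s => (e : R) :=
    ⟨fun e => hs e e.2, fun e f hef => h e e.2 f f.2 (Subtype.coe_ne_coe.2 hef)⟩
  rw [← Finset.prod_coe_sort, horth.prod_one_sub, Finset.sum_coe_sort s fun e => e, hsum, sub_self]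

theorem mainTheorem8_general (𝒞 : BanachKind) (R : Type u) [BanachRing R] [IsOfKind 𝒞 R] :
    (∀ e : R, IsIdempotentElem e →
      ∃ h : IsClosed ((Ideal.span {e} : Ideal R) : Set R),
        (BanAlg.quotient 𝒞 (Ideal.span {e}) h).toMod.IsProjective ∧
        (BanAlg.quotient 𝒞 (Ideal.span {e}) h).IsHomotopyEpi) ∧
    (∀ E : Finset R, (∀ e ∈ E, IsIdempotentElem e) →
      (∏ e ∈ E, e = 0 →
        IsDerivedCover {B : BanAlg 𝒞 R | ∃ e ∈ E,
          ∃ h : IsClosed ((Ideal.span {e} : Ideal R) : Set R),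
            B = BanAlg.quotient 𝒞 (Ideal.span {e}) h} ∧
        IsNonDerivedCover {B : BanAlg 𝒞 R | ∃ e ∈ E,
          ∃ h : IsClosed ((Ideal.span {e} : Ideal R) : Set R),
            B = BanAlg.quotient 𝒞 (Ideal.span {e}) h}) ∧
      (∏ e ∈ E, (1 - e) = 0 →
        IsDerivedCover {B : BanAlg 𝒞 R | ∃ e ∈ E,
          ∃ h : IsClosed ((Ideal.span {1 - e} : Ideal R) : Set R),
            B = BanAlg.quotient 𝒞 (Ideal.span {1 - e}) h} ∧
        IsNonDerivedCover {B : BanAlg 𝒞 R | ∃ e ∈ E,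
          ∃ h : IsClosed ((Ideal.span {1 - e} : Ideal R) : Set R),
            B = BanAlg.quotient 𝒞 (Ideal.span {1 - e}) h})) := by
  classical
  refine ⟨fun e he => ⟨_, BanAlg.isProjective_idempotentQuotient he,
    BanAlg.isHomotopyEpi_idempotentQuotient he⟩, fun E hE =>
    ⟨isDerivedCover_and_isNonDerivedCover_quotient_span_singleton E hE, fun hprod => ?_⟩⟩
  have hprod_image : ∏ f ∈ E.image (1 - ·), f = 0 := by
    rw [Finset.prod_image sub_right_injective.injOn, hprod]
  have h := isDerivedCover_and_isNonDerivedCover_quotient_span_singleton (𝒞 := 𝒞) (E.image (1 - ·))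
    (Finset.forall_mem_image.2 fun e he => (hE e he).one_sub) hprod_image
  simpa only [Finset.exists_mem_image] using h

theorem mainTheorem8 (𝒞 : BanachKind) (R : Type u) [BanachRing R] [IsOfKind 𝒞 R] :
    (∀ e : R, IsIdempotentElem e →
      ∃ h : IsClosed ((Ideal.span {e} : Ideal R) : Set R),
        (BanAlg.quotient 𝒞 (Ideal.span {e}) h).toMod.IsProjective ∧
        (BanAlg.quotient 𝒞 (Ideal.span {e}) h).IsHomotopyEpi) ∧
    (∀ E : Finset R, (∀ e ∈ E, IsIdempotentElem e) →
      (∀ e ∈ E, ∀ f ∈ E, e ≠ f → e * f = 0) → ∑ e ∈ E, e = 1 →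
        ((E ≠ {1} ∨ Subsingleton R) →
          IsDerivedCover {B : BanAlg 𝒞 R | ∃ e ∈ E,
            ∃ h : IsClosed ((Ideal.span {e} : Ideal R) : Set R),
              B = BanAlg.quotient 𝒞 (Ideal.span {e}) h} ∧
          IsNonDerivedCover {B : BanAlg 𝒞 R | ∃ e ∈ E,
            ∃ h : IsClosed ((Ideal.span {e} : Ideal R) : Set R),
              B = BanAlg.quotient 𝒞 (Ideal.span {e}) h}) ∧
        (IsDerivedCover {B : BanAlg 𝒞 R | ∃ e ∈ E,
            ∃ h : IsClosed ((Ideal.span {1 - e} : Ideal R) : Set R),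
              B = BanAlg.quotient 𝒞 (Ideal.span {1 - e}) h} ∧
          IsNonDerivedCover {B : BanAlg 𝒞 R | ∃ e ∈ E,
            ∃ h : IsClosed ((Ideal.span {1 - e} : Ideal R) : Set R),
              B = BanAlg.quotient 𝒞 (Ideal.span {1 - e}) h})) := by
  have h := mainTheorem8_general 𝒞 R
  exact ⟨h.1, fun E hE horth hsum =>
    ⟨fun hne => (h.2 E hE).1 (prod_eq_zero_of_sum_eq_one horth hsum hne),
      (h.2 E hE).2 (prod_one_sub_eq_zero_of_sum_eq_one hE horth hsum)⟩⟩
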